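/- Let $\mathbb S^1=\mathbb R/2\pi\mathbb Z$ carry the uniform probability measure $d\sigma=d\theta/(2\pi)$, let $\|\cdot\|_r$ denote the norm of $L^r(\mathbb S^1,d\sigma)$, and let $H^1(\mathbb S^1,\mathbb C)$ be the space of $2\pi$-periodic absolutely continuous functions $\psi:\mathbb R\to\mathbb C$ with $\psi'\in L^2(\mathbb S^1)$. Let $a\in[0,1/2]$, $p\in[1,2)$ and $q=p/(2-p)$. For $\mu>0$ let $$\lambda_{a,p}(\mu)=\inf\Big\{\|\psi'-i\,a\,\psi\|_2^2+\mu\,\|\psi\|_p^2\;:\;\psi\in H^1(\mathbb S^1,\mathbb C),\ \|\psi\|_2=1\Big\},$$ that is, the optimal constant in the inequality $\|\psi'-i\,a\,\psi\|_2^2+\mu\,\|\psi\|_p^2\ge\lambda_{a,p}(\mu)\,\|\psi\|_2^2$ for all $\psi\in H^1(\mathbb S^1,\mathbb C)$. Let $\phi\ge0$ be a potential on $\mathbb S^1$ such that $\phi^{-1}\in L^q(\mathbb S^1)$ (in particular $\phi>0$ almost everywhere), and let $-(\partial_y-i\,a)^2+\phi$ be the self-adjoint operator associated with the quadratic form $\psi\mapsto\int_{\mathbb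 S^1}\big(|\psi'-i\,a\,\psi|^2+\phi\,|\psi|^2\big)\,d\sigma$ on the form domain $\{\psi\in H^1(\mathbb S^1,\mathbb C):\int_{\mathbb S^1}\phi\,|\psi|^2\,d\sigma<\infty\}$ (in the closure of the form domain in $L^2(\mathbb S^1)$, if it is not dense). Assume that the form domain is not $\{0\}$, which is automatic if $\phi\in L^1(\mathbb S^1)$. Then this operator has a lowest eigenvalue $\lambda_1$, and $$\lambda_1\ge\lambda_{a,p}\big(\|\phi^{-1}\|_q^{-1}\big).$$ Moreover, for every constant potential $\phi\equiv c>0$ such that $\|\phi^{-1}\|_q^{-1}\,(2-p)+4\,a^2\le1$, equality holds: $\lambda_1=\lambda_{a,p}\big(\|\phi^{-1}\|_q^{-1}\big)$. -/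

import Mathlib

open MeasureTheory ComplexConjugate

noncomputable section

namespace MagneticRing

/-- The uniform probability measure `dσ = dθ / (2π)` on the circle. Functions on the circle are
`2π`-periodic functions on `ℝ`, and the circle is represented by the period `(0, 2π]`. -/
def sigma : Measure ℝ :=
  ENNReal.ofReal (2 * Real.pi)⁻¹ • volume.restrict (Set.Ioc 0 (2 * Real.pi))

/-- The norm of `L^r(S¹, dσ)`, for a real exponent `r`. -/
def normLp {E : Type*} [NormedAddCommGroup E] (r : ℝ) (f : ℝ → E) : ℝ :=
  (eLpNorm f (ENNReal.ofReal r) sigma).toReal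

/-- The Sobolev space `H¹(S¹, ℂ)`: the (continuous representatives of the) `2π`-periodic functions
that are absolutely continuous and have a square integrable derivative; the weak
derivative is then the derivative almost everywhere. -/
structure MemH1 (ψ : ℝ → ℂ) : Prop where
  periodic : Function.Periodic ψ (2 * Real.pi)
  absolutelyContinuous : AbsolutelyContinuousOnInterval ψ 0 (2 * Real.pi)
  memLp_deriv : MemLp (deriv ψ) 2 sigma

/-- The magnetic derivative `ψ' - i a ψ`. -/
def magDeriv (a : ℝ) (ψ : ℝ → ℂ) : ℝ → ℂ :=
  fun y => deriv ψ y - Complex.I * (a : ℂ) * ψ y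

/-- `λ_{a,p}(μ)`, the optimal constant in
`‖ψ' - i a ψ‖₂² + μ ‖ψ‖_p² ≥ λ_{a,p}(μ) ‖ψ‖₂²` for all `ψ ∈ H¹(S¹, ℂ)`, that is, the infimum of
the left-hand side over all `ψ ∈ H¹(S¹, ℂ)` with `‖ψ‖₂ = 1`. -/
def optConst (a p μ : ℝ) : ℝ :=
  sInf {e : ℝ | ∃ ψ : ℝ → ℂ, MemH1 ψ ∧ normLp 2 ψ = 1 ∧
    e = normLp 2 (magDeriv a ψ) ^ 2 + μ * normLp p ψ ^ 2}

/-- The form domain of `-(∂_y - i a)² + φ` for a potential `φ ≥ 0`: the functions in `H¹(S¹, ℂ)`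
of finite potential energy. -/
def InFormDomain (φ : ℝ → ℝ) (ψ : ℝ → ℂ) : Prop :=
  MemH1 ψ ∧ Integrable (fun y => φ y * ‖ψ y‖ ^ 2) sigma

/-- The sesquilinear form of `-(∂_y - i a)² + φ`. -/
def magForm (a : ℝ) (φ : ℝ → ℝ) (ψ χ : ℝ → ℂ) : ℂ :=
  (∫ y, magDeriv a ψ y * conj (magDeriv a χ y) ∂sigma) +
    ∫ y, (φ y : ℂ) * (ψ y * conj (χ y)) ∂sigma

/-- The graph of the self-adjoint operator `H = -(∂_y - i a)² + φ` in `L²(S¹)` associated with the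
closed form `magForm a φ`: `ψ` is in the domain of `H`, and `H ψ = f`. (If the form domain is not
dense in `L²(S¹)`, then `H` acts in its closure, and `H ψ` is the projection of `f` onto it.) -/
def IsApply (a : ℝ) (φ : ℝ → ℝ) (ψ f : ℝ → ℂ) : Prop :=
  InFormDomain φ ψ ∧ MemLp f 2 sigma ∧
    ∀ χ : ℝ → ℂ, InFormDomain φ χ → magForm a φ ψ χ = ∫ y, f y * conj (χ y) ∂sigma

/-- The set of eigenvalues of `-(∂_y - i a)² + φ`. -/
def eigenvalues (a : ℝ) (φ : ℝ → ℝ) : Set ℝ :=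
  {e : ℝ | ∃ ψ : ℝ → ℂ, ψ ≠ 0 ∧ IsApply a φ ψ (fun y => (e : ℂ) * ψ y)}

end MagneticRing

end

/-! The lower bound is Hölder duality. Writing |ψ|^p = (φ|ψ|²)^{p/2} φ^{-p/2} gives ‖ψ‖_p² ≤ ‖φ⁻¹‖_q
∫ φ|ψ|² (`normLp_sq_le_mul_integral`), so with μ = ‖φ⁻¹‖_q⁻¹ the quadratic form dominates ‖ψ' -
iaψ‖₂² + μ‖ψ‖_p². A ground state exists by the direct method (`exists_minimizer`,
`exists_ground_state`): bounded energy gives pointwise convergence of a subsequence and weak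
convergence of its magnetic derivatives, the kinetic part is weakly lower semicontinuous, and Fatou
handles the potential. Evaluating the bound at the ground state gives λ₁ ≥ λ_{a,p}(μ).

For φ ≡ c one has μ = c and λ₁ = a² + c, so equality amounts to λ_{a,p}(μ) = a² + μ when μ(2 - p) +
4a² ≤ 1 (`optConst_eq`). Constants give the upper bound. The lower bound combines two inequalities
for u = |ψ|.

The first is `MemH1.magnetic_lower_bound`: ‖ψ' - iaψ‖₂² ≥ a²‖u‖₂² + (1 - 4a²)‖u'‖₂². If ψ vanishes
somewhere, it follows from the diamagnetic inequality and the Dirichlet Wirtinger inequality on an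
interval of length 2π. Otherwise ψ has an integer winding number k, and Cauchy–Schwarz bounds the
phase energy below by 4π²(k - a)²/∫u⁻² ≥ 4π²a²/∫u⁻². This is compared with the same Wirtinger
inequality applied to the real and imaginary parts of an antiperiodic function of modulus u
(`wirtinger_of_pos`).

The second is the sharp interpolation inequality ‖u'‖₂² + μ'‖u‖_p² ≥ μ'‖u‖₂² for μ'(2 - p) ≤ 1
(`interpolation`), used with μ' = μ/(1 - 4a²). It is proved by rigidity: after replacing u² by u² +
δ in the p-norm, a nonnegative minimiser is a positive classical solution of its Euler–Lagrange
equation, and the carré du champ estimate together with Poincaré's inequality makes it constant.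
Then δ → 0, and μ' reaches the critical value by a limit from below. -/

noncomputable section

namespace MagneticRing

open Set Filter Topology

/-! ### Calculus of absolutely continuous functions on the whole line. -/

section LocallyAbsolutelyContinuous

variable {X Y E : Type*} [PseudoMetricSpace X] [PseudoMetricSpace Y]
  [NormedAddCommGroup E]

/-- Functions on the line that are absolutely continuous on every compact interval. -/
def LocAC (f : ℝ → X) : Prop := ∀ a b : ℝ, AbsolutelyContinuousOnInterval f a b

/-- The increments of `h` are dominated by those of `f`. This transfers absolute continuity to
norms, to real and imaginary parts, and to compositions with C¹ maps. -/
theorem absolutelyContinuousOnInterval_of_dist_le {f : ℝ → X} {h : ℝ → Y} {a b C : ℝ}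
    (hf : AbsolutelyContinuousOnInterval f a b)
    (hC : ∀ x ∈ uIcc a b, ∀ y ∈ uIcc a b, dist (h x) (h y) ≤ C * dist (f x) (f y)) :
    AbsolutelyContinuousOnInterval h a b := by
  unfold AbsolutelyContinuousOnInterval at hf ⊢
  refine squeeze_zero' (Eventually.of_forall fun _ => Finset.sum_nonneg fun _ _ => dist_nonneg) ?_
    (by simpa using hf.const_mul C)
  refine Filter.Eventually.filter_mono inf_le_right ?_
  rw [Filter.eventually_principal]
  intro E hE
  rw [Finset.mul_sum]
  refine Finset.sum_le_sum fun i hi => ?_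
  have := hE.1 i hi
  exact hC _ this.1 _ this.2

theorem LocAC.of_dist_le {f : ℝ → X} {h : ℝ → Y} (hf : LocAC f) (C : ℝ)
    (hC : ∀ x y, dist (h x) (h y) ≤ C * dist (f x) (f y)) : LocAC h := fun a b =>
  absolutelyContinuousOnInterval_of_dist_le (hf a b) fun x _ y _ => hC x y

theorem LocAC.continuous {f : ℝ → E} (hf : LocAC f) : Continuous f := by
  rw [continuous_iff_continuousAt]
  intro x
  have hx : Icc (x - 1) (x + 1) ∈ 𝓝 x := Icc_mem_nhds (by linarith) (by linarith)
  rw [← uIcc_of_le (show x - 1 ≤ x + 1 by linarith)] at hx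
  exact (hf (x - 1) (x + 1)).continuousOn.continuousAt hx

theorem LocAC.add {f g : ℝ → E} (hf : LocAC f) (hg : LocAC g) : LocAC (fun x => f x + g x) :=
  fun a b => (hf a b).fun_add (hg a b)

theorem LocAC.sub {f g : ℝ → E} (hf : LocAC f) (hg : LocAC g) : LocAC (fun x => f x - g x) :=
  fun a b => (hf a b).fun_sub (hg a b)

theorem LocAC.mul {M : Type*} [NormedField M] [NormedSpace ℝ M] {f g : ℝ → M}
    (hf : LocAC f) (hg : LocAC g) : LocAC (fun x => f x * g x) := fun a b => by
  simpa only [smul_eq_mul] using (hf a b).fun_smul (hg a b)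

theorem LocAC.const (c : E) : LocAC (fun _ : ℝ => c) := fun a b => by
  have : LipschitzOnWith 0 (fun _ : ℝ => c) (uIcc a b) := by
    intro x _ y _
    simp
  exact this.absolutelyContinuousOnInterval

theorem locallyIntegrable_of_intervalIntegrable {g : ℝ → E}
    (hg : ∀ a b, IntervalIntegrable g volume a b) : LocallyIntegrable g volume := by
  intro x
  refine ⟨Ioc (x - 1) (x + 1), ?_, (hg (x - 1) (x + 1)).1⟩
  exact Ioc_mem_nhds (by linarith) (by linarith)

theorem LocAC.norm {f : ℝ → E} (hf : LocAC f) : LocAC (fun x => ‖f x‖) :=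
  hf.of_dist_le 1 fun x y => by
    rw [one_mul, Real.dist_eq, dist_eq_norm]
    exact abs_norm_sub_norm_le _ _

variable [NormedSpace ℝ E]

theorem locAC_of_contDiff {f : ℝ → E} (hf : ContDiff ℝ 1 f) : LocAC f :=
  fun _ _ => hf.contDiffOn.absolutelyContinuousOnInterval

theorem LocAC.re {f : ℝ → ℂ} (hf : LocAC f) : LocAC (fun x => (f x).re) :=
  hf.of_dist_le 1 fun x y => by
    rw [one_mul, Real.dist_eq, dist_eq_norm, ← Complex.sub_re]
    exact Complex.abs_re_le_norm _

theorem LocAC.im {f : ℝ → ℂ} (hf : LocAC f) : LocAC (fun x => (f x).im) :=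
  hf.of_dist_le 1 fun x y => by
    rw [one_mul, Real.dist_eq, dist_eq_norm, ← Complex.sub_im]
    exact Complex.abs_im_le_norm _

theorem LocAC.ofReal {f : ℝ → ℝ} (hf : LocAC f) : LocAC (fun x => (f x : ℂ)) :=
  hf.of_dist_le 1 fun x y => by
    rw [one_mul, Real.dist_eq, dist_eq_norm, ← Complex.ofReal_sub, Complex.norm_real,
      Real.norm_eq_abs]

theorem locAC_of_re_im {f : ℝ → ℂ} (h₁ : LocAC fun x => (f x).re) (h₂ : LocAC fun x => (f x).im) :
    LocAC f := by
  have := h₁.ofReal.add (h₂.ofReal.mul (LocAC.const Complex.I))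
  simpa only [Complex.re_add_im] using this

theorem LocAC.comp_contDiff {F : Type*} [NormedAddCommGroup F] [NormedSpace ℝ F]
    [FiniteDimensional ℝ E] {f : ℝ → E} {g : E → F} (hf : LocAC f) (hg : ContDiff ℝ 1 g) :
    LocAC (fun x => g (f x)) := by
  intro a b
  obtain ⟨R, hR⟩ := (hf a b).exists_bound
  have : ProperSpace E := FiniteDimensional.proper_real E
  obtain ⟨K, hK⟩ := hg.contDiffOn.exists_lipschitzOnWith (by decide)
    (convex_closedBall (0 : E) R) (isCompact_closedBall (0 : E) R)
  refine absolutelyContinuousOnInterval_of_dist_le (C := K) (hf a b) fun x hx y hy => ?_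
  exact hK.dist_le_mul _ (by simpa using hR x hx) _ (by simpa using hR y hy)

theorem LocAC.ae_differentiableAt [FiniteDimensional ℝ E] {f : ℝ → E} (hf : LocAC f) :
    ∀ᵐ x : ℝ, DifferentiableAt ℝ f x := by
  have h : ∀ n : ℕ, ∀ᵐ x : ℝ, x ∈ uIcc (-(n : ℝ)) n → DifferentiableAt ℝ f x := fun n =>
    (hf _ _).boundedVariationOn.ae_differentiableAt_of_mem_uIcc
  filter_upwards [ae_all_iff.2 h] with x hx
  obtain ⟨n, hn⟩ := exists_nat_ge |x|
  refine hx n ?_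
  rw [uIcc_of_le (by linarith [abs_nonneg x])]
  exact abs_le.1 hn

theorem LocAC.intervalIntegrable_deriv {f : ℝ → ℂ} (hf : LocAC f) (a b : ℝ) :
    IntervalIntegrable (deriv f) volume a b := by
  have h₁ := (hf.re a b).intervalIntegrable_deriv
  have h₂ := (hf.im a b).intervalIntegrable_deriv
  have h : IntervalIntegrable (fun x => ((deriv (fun x => (f x).re) x : ℝ) : ℂ) +
      ((deriv (fun x => (f x).im) x : ℝ) : ℂ) * Complex.I) volume a b := by
    refine IntervalIntegrable.add ?_ (IntervalIntegrable.mul_const ?_ _)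
    · exact ⟨h₁.1.ofReal, h₁.2.ofReal⟩
    · exact ⟨h₂.1.ofReal, h₂.2.ofReal⟩
  refine h.congr_ae ?_
  refine ae_restrict_of_ae ?_
  filter_upwards [hf.ae_differentiableAt] with x hx
  have e₁ : HasDerivAt (fun x => (f x).re) (deriv f x).re x :=
    Complex.reCLM.hasFDerivAt.comp_hasDerivAt x hx.hasDerivAt
  have e₂ : HasDerivAt (fun x => (f x).im) (deriv f x).im x :=
    Complex.imCLM.hasFDerivAt.comp_hasDerivAt x hx.hasDerivAt
  rw [e₁.deriv, e₂.deriv, Complex.re_add_im]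

theorem hasDerivAt_re {f : ℝ → ℂ} {x : ℝ} {f' : ℂ} (h : HasDerivAt f f' x) :
    HasDerivAt (fun x => (f x).re) f'.re x := Complex.reCLM.hasFDerivAt.comp_hasDerivAt x h

theorem hasDerivAt_im {f : ℝ → ℂ} {x : ℝ} {f' : ℂ} (h : HasDerivAt f f' x) :
    HasDerivAt (fun x => (f x).im) f'.im x := Complex.imCLM.hasFDerivAt.comp_hasDerivAt x h

theorem intervalIntegral_re {f : ℝ → ℂ} {a b : ℝ} (h : IntervalIntegrable f volume a b) :
    (∫ x in a..b, f x).re = ∫ x in a..b, (f x).re :=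
  (Complex.reCLM.intervalIntegral_comp_comm h).symm

theorem intervalIntegral_im {f : ℝ → ℂ} {a b : ℝ} (h : IntervalIntegrable f volume a b) :
    (∫ x in a..b, f x).im = ∫ x in a..b, (f x).im :=
  (Complex.imCLM.intervalIntegral_comp_comm h).symm

theorem LocAC.integral_deriv {f : ℝ → ℂ} (hf : LocAC f) (a b : ℝ) :
    ∫ x in a..b, deriv f x = f b - f a := by
  have hi := hf.intervalIntegrable_deriv a b
  apply Complex.ext
  · rw [intervalIntegral_re hi, Complex.sub_re, ← (hf.re a b).integral_deriv_eq_sub]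
    refine intervalIntegral.integral_congr_ae ?_
    filter_upwards [hf.ae_differentiableAt] with x hx _
    exact (hasDerivAt_re hx.hasDerivAt).deriv.symm
  · rw [intervalIntegral_im hi, Complex.sub_im, ← (hf.im a b).integral_deriv_eq_sub]
    refine intervalIntegral.integral_congr_ae ?_
    filter_upwards [hf.ae_differentiableAt] with x hx _
    exact (hasDerivAt_im hx.hasDerivAt).deriv.symm

theorem locAC_integral_real {g : ℝ → ℝ} (hg : ∀ a b, IntervalIntegrable g volume a b) (c : ℝ) :
    LocAC (fun x => ∫ t in c..x, g t) := by
  intro a b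
  have h := (hg (min a c) (max b c)).absolutelyContinuousOnInterval_intervalIntegral (c := a)
  have h₁ : AbsolutelyContinuousOnInterval (fun x => ∫ t in a..x, g t) a b :=
    (hg a b).absolutelyContinuousOnInterval_intervalIntegral left_mem_uIcc
  refine absolutelyContinuousOnInterval_of_dist_le (C := 1) h₁ fun x _ y _ => ?_
  rw [one_mul, Real.dist_eq, Real.dist_eq, intervalIntegral.integral_interval_sub_left (hg _ _)
    (hg _ _), intervalIntegral.integral_interval_sub_left (hg _ _) (hg _ _)]

theorem locAC_integral {g : ℝ → ℂ} (hg : ∀ a b, IntervalIntegrable g volume a b) (c : ℝ) :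
    LocAC (fun x => ∫ t in c..x, g t) := by
  refine locAC_of_re_im ?_ ?_
  · simp only [intervalIntegral_re (hg _ _)]
    exact locAC_integral_real (fun a b => ⟨(hg a b).1.re, (hg a b).2.re⟩) c
  · simp only [intervalIntegral_im (hg _ _)]
    exact locAC_integral_real (fun a b => ⟨(hg a b).1.im, (hg a b).2.im⟩) c

theorem LocAC.eq_of_deriv_eq_zero {f : ℝ → E} (hf : LocAC f) (h : ∀ᵐ x : ℝ, HasDerivAt f 0 x)
    (x y : ℝ) : f x = f y := by
  obtain ⟨C, hC⟩ := (hf x y).const_of_ae_hasDerivAt_zero (h.mono fun _ hx _ => hx)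
  rw [hC x left_mem_uIcc, hC y right_mem_uIcc]

end LocallyAbsolutelyContinuous

/-! ### The normalised measure on the circle and its norms. -/

section Sigma

theorem ae_sigma_iff {P : ℝ → Prop} :
    (∀ᵐ y ∂sigma, P y) ↔ ∀ᵐ y ∂volume.restrict (Ioc 0 (2 * Real.pi)), P y := by
  unfold sigma
  rw [Measure.ae_ennreal_smul_measure_iff]
  exact (ENNReal.ofReal_pos.2 (inv_pos.2 Real.two_pi_pos)).ne'

theorem ae_sigma_of_ae {P : ℝ → Prop} (h : ∀ᵐ y : ℝ, P y) : ∀ᵐ y ∂sigma, P y :=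
  ae_sigma_iff.2 (ae_restrict_of_ae h)

instance : IsProbabilityMeasure sigma := by
  constructor
  simp only [sigma, Measure.smul_apply, Measure.restrict_apply_univ, Real.volume_Ioc, sub_zero,
    smul_eq_mul]
  rw [← ENNReal.ofReal_mul (inv_nonneg.2 Real.two_pi_pos.le),
    inv_mul_cancel₀ Real.two_pi_pos.ne', ENNReal.ofReal_one]

variable {E : Type*} [NormedAddCommGroup E]

theorem integrable_sigma_iff {f : ℝ → E} :
    Integrable f sigma ↔ IntervalIntegrable f volume 0 (2 * Real.pi) := by
  rw [intervalIntegrable_iff_integrableOn_Ioc_of_le Real.two_pi_pos.le, IntegrableOn, sigma,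
    integrable_smul_measure (ENNReal.ofReal_pos.2 (inv_pos.2 Real.two_pi_pos)).ne'
      ENNReal.ofReal_ne_top]

theorem integral_sigma [NormedSpace ℝ E] (f : ℝ → E) :
    ∫ y, f y ∂sigma = (2 * Real.pi)⁻¹ • ∫ y in (0)..(2 * Real.pi), f y := by
  rw [sigma, integral_smul_measure, ENNReal.toReal_ofReal (inv_nonneg.2 Real.two_pi_pos.le),
    intervalIntegral.integral_of_le Real.two_pi_pos.le]

theorem memLp_sigma_of_continuous {f : ℝ → E} (hf : Continuous f) (r : ENNReal) :
    MemLp f r sigma := by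
  obtain ⟨C, hC⟩ := isCompact_Icc.exists_bound_of_continuousOn
    (hf.continuousOn (s := Icc 0 (2 * Real.pi)))
  refine MemLp.of_bound hf.aestronglyMeasurable C ?_
  rw [ae_sigma_iff]
  filter_upwards [ae_restrict_mem measurableSet_Ioc] with x hx
  exact hC x (Ioc_subset_Icc_self hx)

theorem integrable_sigma_of_continuous {f : ℝ → E} (hf : Continuous f) : Integrable f sigma :=
  memLp_one_iff_integrable.1 (memLp_sigma_of_continuous hf 1)

theorem normLp_two_sq {f : ℝ → E} (hf : MemLp f 2 sigma) :
    normLp 2 f ^ 2 = ∫ y, ‖f y‖ ^ 2 ∂sigma := by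
  have h0 : 0 ≤ ∫ y, ‖f y‖ ^ 2 ∂sigma := integral_nonneg fun _ => by positivity
  have h2 : (ENNReal.ofReal 2) = 2 := by norm_num
  rw [normLp, h2, hf.eLpNorm_eq_integral_rpow_norm (by norm_num) (by norm_num)]
  simp only [ENNReal.toReal_ofNat, Real.rpow_two]
  rw [ENNReal.toReal_ofReal (by positivity), ← Real.rpow_natCast, ← Real.rpow_mul h0]
  norm_num

theorem normLp_nonneg (r : ℝ) (f : ℝ → E) : 0 ≤ normLp r f := ENNReal.toReal_nonneg

theorem normLp_eq {f : ℝ → E} {r : ℝ} (hr : 0 < r) (hf : MemLp f (ENNReal.ofReal r) sigma) :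
    normLp r f = (∫ y, ‖f y‖ ^ r ∂sigma) ^ r⁻¹ := by
  have h0 : 0 ≤ ∫ y, ‖f y‖ ^ r ∂sigma := integral_nonneg fun _ => by positivity
  rw [normLp, hf.eLpNorm_eq_integral_rpow_norm (by simpa using hr) (by simp),
    ENNReal.toReal_ofReal hr.le, ENNReal.toReal_ofReal (by positivity)]

theorem normLp_const {r : ℝ} (hr : 0 < r) (c : E) : normLp r (fun _ => c) = ‖c‖ := by
  rw [normLp_eq hr (memLp_const c)]
  simp only [integral_const, probReal_univ, one_smul]
  exact Real.rpow_rpow_inv (norm_nonneg c) hr.ne'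

theorem integral_pos_of_continuous {f : ℝ → ℝ} (hf : Continuous f) (h0 : ∀ x, 0 ≤ f x)
    (hper : Function.Periodic f (2 * Real.pi)) (hne : ∃ x, f x ≠ 0) : 0 < ∫ y, f y ∂sigma := by
  obtain ⟨x, hx⟩ := hne
  obtain ⟨y, hy, hxy⟩ := hper.exists_mem_Ico₀ Real.two_pi_pos x
  rw [integral_sigma]
  refine smul_pos (inv_pos.2 Real.two_pi_pos) ?_
  refine intervalIntegral.integral_pos Real.two_pi_pos hf.continuousOn (fun z _ => h0 z)
    ⟨y, Ico_subset_Icc_self hy, ?_⟩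
  rw [← hxy]
  exact lt_of_le_of_ne (h0 x) hx.symm

end Sigma

/-! ### Periodic H¹ functions, their moduli, and the diamagnetic inequality. -/

section Sobolev

variable {ψ χ : ℝ → ℂ}

theorem periodic_integral_of_eq_zero {E : Type*} [NormedAddCommGroup E] [NormedSpace ℝ E]
    {g : ℝ → E} {T : ℝ} (hg : Function.Periodic g T) (hi : ∀ a b, IntervalIntegrable g volume a b)
    (h0 : ∫ t in (0)..T, g t = 0) : Function.Periodic (fun x => ∫ t in (0)..x, g t) T := by
  intro x
  have := hg.intervalIntegral_add_eq x 0
  rw [zero_add] at this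
  simp only
  rw [← intervalIntegral.integral_add_adjacent_intervals (hi 0 x) (hi x (x + T)), this, h0,
    add_zero]

theorem periodic_deriv {E : Type*} [NormedAddCommGroup E] [NormedSpace ℝ E] {f : ℝ → E} {T : ℝ}
    (hf : Function.Periodic f T) : Function.Periodic (deriv f) T := by
  intro x
  have : (fun y => f (y + T)) = f := funext hf
  rw [← deriv_comp_add_const f T x, this]

theorem MemH1.intervalIntegrable_deriv (h : MemH1 ψ) (a b : ℝ) :
    IntervalIntegrable (deriv ψ) volume a b :=
  (periodic_deriv h.periodic).intervalIntegrable₀ Real.two_pi_pos.ne'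
    (integrable_sigma_iff.1 (h.memLp_deriv.integrable (by norm_num))) a b

/-- The definition gives absolute continuity on one period only. There `ψ` differs by a constant
from the primitive `G` of its derivative; periodicity of `ψ` forces `G (2π) = 0`, so `G` is periodic
too and the identity extends to the line. -/
theorem MemH1.locAC (h : MemH1 ψ) : LocAC ψ := by
  have hi := h.intervalIntegrable_deriv
  have hG := locAC_integral hi 0
  set G : ℝ → ℂ := fun x => ∫ t in (0)..x, deriv ψ t with hGdef
  have hpi := Real.two_pi_pos
  obtain ⟨C, hC⟩ := (h.absolutelyContinuous.fun_sub (hG 0 (2 * Real.pi))).const_of_ae_hasDerivAt_zero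
    (by
      filter_upwards [h.absolutelyContinuous.boundedVariationOn.ae_differentiableAt_of_mem_uIcc,
        LocallyIntegrable.ae_hasDerivAt_integral (locallyIntegrable_of_intervalIntegrable hi)] with x h1 h2 hx
      simpa [hGdef] using (h1 hx).hasDerivAt.fun_sub (h2 0))
  rw [uIcc_of_le hpi.le] at hC
  have h0 := hC 0 (left_mem_Icc.2 hpi.le)
  have h1 := hC _ (right_mem_Icc.2 hpi.le)
  have hper0 : ψ (2 * Real.pi) = ψ 0 := by simpa using h.periodic 0
  have hG0 : G 0 = 0 := by simp [hGdef]
  have hG1 : G (2 * Real.pi) = 0 := by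
    rw [hG0, sub_zero] at h0
    rw [hper0, ← h0] at h1
    simpa using h1
  have hGp : Function.Periodic G (2 * Real.pi) :=
    periodic_integral_of_eq_zero (periodic_deriv h.periodic) hi hG1
  have hD : ∀ x, ψ x = C + G x := by
    intro x
    obtain ⟨y, hy, hxy⟩ := (h.periodic.sub hGp).exists_mem_Ico₀ hpi x
    have := hC y (Ico_subset_Icc_self hy)
    simp only [Pi.sub_apply] at hxy
    rw [← hxy] at this
    rw [← this]
    ring
  rw [show ψ = fun x => C + G x from funext hD]
  exact (LocAC.const C).add hG

theorem MemH1.continuous (h : MemH1 ψ) : Continuous ψ := h.locAC.continuous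

theorem MemH1.of_locAC (hp : Function.Periodic ψ (2 * Real.pi)) (h : LocAC ψ)
    (hd : MemLp (deriv ψ) 2 sigma) : MemH1 ψ := ⟨hp, h _ _, hd⟩

theorem MemH1.ae_differentiableAt (h : MemH1 ψ) : ∀ᵐ x ∂sigma, DifferentiableAt ℝ ψ x :=
  ae_sigma_of_ae h.locAC.ae_differentiableAt

theorem MemH1.memLp (h : MemH1 ψ) (r : ENNReal) : MemLp ψ r sigma :=
  memLp_sigma_of_continuous h.continuous r

theorem MemH1.memLp_magDeriv (h : MemH1 ψ) (a : ℝ) : MemLp (magDeriv a ψ) 2 sigma :=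
  h.memLp_deriv.sub ((h.memLp 2).const_mul _)

theorem MemH1.ae_deriv_add (h₁ : MemH1 ψ) (h₂ : MemH1 χ) :
    ∀ᵐ x ∂sigma, deriv (fun x => ψ x + χ x) x = deriv ψ x + deriv χ x := by
  filter_upwards [h₁.ae_differentiableAt, h₂.ae_differentiableAt] with x hx hy
  exact deriv_fun_add hx hy

theorem MemH1.add (h₁ : MemH1 ψ) (h₂ : MemH1 χ) : MemH1 (fun x => ψ x + χ x) :=
  .of_locAC (h₁.periodic.add h₂.periodic) (h₁.locAC.add h₂.locAC)
    ((h₁.memLp_deriv.add h₂.memLp_deriv).ae_eq ((h₁.ae_deriv_add h₂).mono fun _ h => h.symm))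

theorem MemH1.const_mul (h : MemH1 ψ) (c : ℂ) : MemH1 (fun x => c * ψ x) := by
  refine .of_locAC (fun x => by simp only [h.periodic x]) ((LocAC.const c).mul h.locAC) ?_
  rw [show deriv (fun x => c * ψ x) = fun x => c * deriv ψ x from funext fun x => by simp]
  exact h.memLp_deriv.const_mul c

theorem memH1_const (c : ℂ) : MemH1 (fun _ => c) :=
  .of_locAC (fun _ => rfl) (LocAC.const c) (by simp)

theorem magDeriv_add (h₁ : MemH1 ψ) (h₂ : MemH1 χ) (a : ℝ) :
    ∀ᵐ x ∂sigma, magDeriv a (fun x => ψ x + χ x) x = magDeriv a ψ x + magDeriv a χ x := by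
  filter_upwards [h₁.ae_deriv_add h₂] with x hx
  simp only [magDeriv, hx]
  ring

theorem magDeriv_const_mul (a : ℝ) (c : ℂ) (ψ : ℝ → ℂ) (x : ℝ) :
    magDeriv a (fun x => c * ψ x) x = c * magDeriv a ψ x := by
  simp only [magDeriv, deriv_const_mul_field']
  ring

/-- A primitive of a square integrable function, made periodic, is in `H¹`. -/
theorem memH1_of_primitive {g : ℝ → ℂ} (hψ : Function.Periodic ψ (2 * Real.pi))
    (hg : MemLp g 2 sigma)
    (h : ∀ x ∈ Icc 0 (2 * Real.pi), ψ x = ψ 0 + ∫ t in (0)..x, g t) :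
    MemH1 ψ ∧ deriv ψ =ᵐ[sigma] g := by
  have hpi := Real.two_pi_pos
  -- `g` is controlled on (0, 2π] only; the cut-off makes its primitive absolutely continuous on the
  -- line.
  set g₁ : ℝ → ℂ := indicator (Ioc 0 (2 * Real.pi)) g with hg₁
  have hgi : IntegrableOn g (Ioc 0 (2 * Real.pi)) volume := by
    have := integrable_sigma_iff.1 (hg.integrable (by norm_num))
    rwa [intervalIntegrable_iff_integrableOn_Ioc_of_le hpi.le] at this
  have hi : ∀ a b, IntervalIntegrable g₁ volume a b := fun a b =>
    ((integrable_indicator_iff measurableSet_Ioc).2 hgi).intervalIntegrable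
  have h' : ∀ x ∈ Icc 0 (2 * Real.pi), ψ x = ψ 0 + ∫ t in (0)..x, g₁ t := by
    intro x hx
    rw [h x hx]
    congr 1
    refine intervalIntegral.integral_congr_ae (Eventually.of_forall fun t ht => ?_)
    rw [uIoc_of_le hx.1] at ht
    have hmem : t ∈ Ioc 0 (2 * Real.pi) := ⟨ht.1, ht.2.trans hx.2⟩
    rw [hg₁, indicator_of_mem hmem]
  have hG := (LocAC.const (ψ 0)).add (locAC_integral hi 0)
  have hd : deriv ψ =ᵐ[sigma] g := by
    rw [EventuallyEq, ae_sigma_iff, ae_restrict_iff' measurableSet_Ioc]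
    -- At the right endpoint the primitive formula holds on one side only and does not determine the
    -- derivative.
    have hne : ∀ᵐ x : ℝ, x ≠ 2 * Real.pi := by simp [ae_iff, measure_singleton]
    filter_upwards [LocallyIntegrable.ae_hasDerivAt_integral (locallyIntegrable_of_intervalIntegrable hi), hne]
      with x hx hxne hmem
    have hev : ψ =ᶠ[𝓝 x] fun x => ψ 0 + ∫ t in (0)..x, g₁ t := by
      filter_upwards [Ioo_mem_nhds hmem.1 (lt_of_le_of_ne hmem.2 hxne)] with y hy
      exact h' y (Ioo_subset_Icc_self hy)
    rw [hev.deriv_eq, ((hx 0).const_add (ψ 0)).deriv, hg₁, indicator_of_mem hmem]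
  refine ⟨⟨hψ, ?_, hg.ae_eq hd.symm⟩, hd⟩
  refine absolutelyContinuousOnInterval_of_dist_le (C := 1) (hG 0 (2 * Real.pi)) ?_
  intro x hx y hy
  rw [uIcc_of_le hpi.le] at hx hy
  rw [h' x hx, h' y hy, one_mul]

theorem MemH1.integral_deriv_eq_zero (h : MemH1 ψ) : ∫ y, deriv ψ y ∂sigma = 0 := by
  rw [integral_sigma, h.locAC.integral_deriv]
  have : ψ (2 * Real.pi) = ψ 0 := by simpa using h.periodic 0
  rw [this, sub_self, smul_zero]

/-- At a common point of differentiability of `ψ` and `|ψ|`, the derivative of `|ψ|`. -/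
theorem norm_mul_deriv_norm {x : ℝ} (h : DifferentiableAt ℝ ψ x)
    (hn : DifferentiableAt ℝ (fun x => ‖ψ x‖) x) :
    ‖ψ x‖ * deriv (fun x => ‖ψ x‖) x = (conj (ψ x) * deriv ψ x).re := by
  have h1 : HasDerivAt (fun x => ‖ψ x‖ ^ 2) (2 * ‖ψ x‖ * deriv (fun x => ‖ψ x‖) x) x := by
    simpa using hn.hasDerivAt.fun_pow 2
  have h2 : HasDerivAt (fun x => ‖ψ x‖ ^ 2)
      (2 * (ψ x).re * (deriv ψ x).re + 2 * (ψ x).im * (deriv ψ x).im) x := by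
    have e := ((hasDerivAt_re h.hasDerivAt).fun_pow 2).fun_add
      ((hasDerivAt_im h.hasDerivAt).fun_pow 2)
    have : (fun x => ‖ψ x‖ ^ 2) = fun x => (ψ x).re ^ 2 + (ψ x).im ^ 2 := by
      funext y
      simp only [← Complex.normSq_eq_norm_sq, Complex.normSq_apply]
      ring
    rw [this]
    simpa using e
  have := h1.unique h2
  simp only [Complex.mul_re, Complex.conj_re, Complex.conj_im]
  linarith

/-- Where `ψ ≠ 0`, the magnetic term contributes -ia|ψ|² to conj(ψ) · (ψ' - iaψ), which has no real
part. At a zero, |ψ| has a minimum, so its derivative vanishes. -/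
theorem abs_deriv_norm_le {x : ℝ} (a : ℝ) (h : DifferentiableAt ℝ ψ x)
    (hn : DifferentiableAt ℝ (fun x => ‖ψ x‖) x) :
    |deriv (fun x => ‖ψ x‖) x| ≤ ‖magDeriv a ψ x‖ := by
  by_cases h0 : ψ x = 0
  · have hmin : IsLocalMin (fun x => ‖ψ x‖) x :=
      Eventually.of_forall fun y => by simp [h0]
    rw [hmin.deriv_eq_zero, abs_zero]
    exact norm_nonneg _
  · have hpos : 0 < ‖ψ x‖ := norm_pos_iff.2 h0
    have key : ‖ψ x‖ * deriv (fun x => ‖ψ x‖) x = (conj (ψ x) * magDeriv a ψ x).re := by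
      rw [norm_mul_deriv_norm h hn]
      simp only [magDeriv, Complex.mul_re, Complex.sub_re, Complex.sub_im, Complex.mul_im,
        Complex.conj_re, Complex.conj_im, Complex.I_re, Complex.I_im, Complex.ofReal_re,
        Complex.ofReal_im]
      ring
    have := Complex.abs_re_le_norm (conj (ψ x) * magDeriv a ψ x)
    rw [← key, norm_mul, RCLike.norm_conj, abs_mul, abs_of_pos hpos] at this
    exact le_of_mul_le_mul_left this hpos

theorem MemH1.ae_differentiableAt_norm (h : MemH1 ψ) :
    ∀ᵐ x ∂sigma, DifferentiableAt ℝ ψ x ∧ DifferentiableAt ℝ (fun x => ‖ψ x‖) x := by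
  filter_upwards [h.ae_differentiableAt, ae_sigma_of_ae h.locAC.norm.ae_differentiableAt]
    with x h1 h2 using ⟨h1, h2⟩

theorem MemH1.memLp_deriv_norm (h : MemH1 ψ) : MemLp (deriv fun x => ‖ψ x‖) 2 sigma := by
  refine MemLp.of_le (h.memLp_magDeriv 0) (measurable_deriv _).aestronglyMeasurable ?_
  filter_upwards [h.ae_differentiableAt_norm] with x hx
  exact abs_deriv_norm_le 0 hx.1 hx.2

theorem MemH1.of_real {u : ℝ → ℝ} (hp : Function.Periodic u (2 * Real.pi)) (hu : LocAC u)
    (hd : MemLp (deriv u) 2 sigma) :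
    MemH1 (fun x => (u x : ℂ)) ∧
      deriv (fun x => (u x : ℂ)) =ᵐ[sigma] fun x => ((deriv u x : ℝ) : ℂ) := by
  have hae : deriv (fun x => (u x : ℂ)) =ᵐ[sigma] fun x => ((deriv u x : ℝ) : ℂ) := by
    filter_upwards [ae_sigma_of_ae hu.ae_differentiableAt] with x hx
    exact hx.hasDerivAt.ofReal_comp.deriv
  refine ⟨.of_locAC (fun x => by simp only [hp x]) hu.ofReal ?_, hae⟩
  exact MemLp.ae_eq hae.symm hd.ofReal

theorem MemH1.norm (h : MemH1 ψ) :
    MemH1 (fun x => ((‖ψ x‖ : ℝ) : ℂ)) ∧ deriv (fun x => ((‖ψ x‖ : ℝ) : ℂ)) =ᵐ[sigma]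
      fun x => ((deriv (fun x => ‖ψ x‖) x : ℝ) : ℂ) :=
  MemH1.of_real (fun x => by simp only [h.periodic x]) h.locAC.norm h.memLp_deriv_norm

/-- The diamagnetic inequality. -/
theorem MemH1.integral_deriv_norm_sq_le (h : MemH1 ψ) (a : ℝ) :
    ∫ y, deriv (fun x => ‖ψ x‖) y ^ 2 ∂sigma ≤ ∫ y, ‖magDeriv a ψ y‖ ^ 2 ∂sigma := by
  refine integral_mono_ae ?_ ((h.memLp_magDeriv a).integrable_norm_pow (by norm_num)) ?_
  · simpa using h.memLp_deriv_norm.integrable_norm_pow (by norm_num)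
  · filter_upwards [h.ae_differentiableAt_norm] with x hx
    rw [← sq_abs]
    exact pow_le_pow_left₀ (abs_nonneg _) (abs_deriv_norm_le a hx.1 hx.2) 2

end Sobolev

/-! ### Weak limits in Hilbert space and lower semicontinuity of the norm. -/

section WeakCompactness

variable {H : Type*} [NormedAddCommGroup H] [InnerProductSpace ℂ H]

/-- Bounded sequences in a separable Hilbert space have weakly convergent subsequences. -/
theorem exists_subseq_tendsto_inner [CompleteSpace H] [TopologicalSpace.SeparableSpace H]
    (x : ℕ → H) (R : ℝ) (hx : ∀ n, ‖x n‖ ≤ R) :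
    ∃ (y : H) (φ : ℕ → ℕ), StrictMono φ ∧
      ∀ h, Tendsto (fun n => inner ℂ (x (φ n)) h) atTop (𝓝 (inner ℂ y h)) := by
  obtain ⟨L, -, φ, hφ, hL⟩ := (WeakDual.isSeqCompact_closedBall ℂ H 0 R)
    (x := fun n => StrongDual.toWeakDual (InnerProductSpace.toDual ℂ H (x n))) (fun n => by
      simpa using hx n)
  refine ⟨(InnerProductSpace.toDual ℂ H).symm (WeakDual.toStrongDual L), φ, hφ, fun h => ?_⟩
  rw [InnerProductSpace.toDual_symm_apply]
  exact ((WeakDual.eval_continuous h).tendsto L).comp hL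

/-- Expanding 0 ≤ ‖xₙ - y‖² gives ‖xₙ‖² ≥ 2 Re⟨xₙ, y⟩ - ‖y‖², whose right side tends to ‖y‖². -/
theorem le_liminf_norm_sq_of_tendsto_inner {x : ℕ → H} {y : H}
    (h : Tendsto (fun n => inner ℂ (x n) y) atTop (𝓝 (inner ℂ y y))) :
    ENNReal.ofReal (‖y‖ ^ 2) ≤ liminf (fun n => ENNReal.ofReal (‖x n‖ ^ 2)) atTop := by
  have hre : Tendsto (fun n => 2 * (inner ℂ (x n) y).re - ‖y‖ ^ 2) atTop (𝓝 (‖y‖ ^ 2)) := by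
    have h1 := (((Complex.continuous_re.tendsto _).comp h).const_mul 2).sub_const (‖y‖ ^ 2)
    have h2 : (inner ℂ y y).re = ‖y‖ ^ 2 := by
      rw [inner_self_eq_norm_sq_to_K]
      norm_cast
    rw [h2] at h1
    rwa [two_mul (‖y‖ ^ 2), add_sub_cancel_right] at h1
  have := ENNReal.tendsto_ofReal hre
  rw [← this.liminf_eq]
  refine liminf_le_liminf (Eventually.of_forall fun n => ENNReal.ofReal_le_ofReal ?_)
  have h3 := @norm_sub_sq ℂ H _ _ _ (x n) y
  have h4 : 0 ≤ ‖x n - y‖ ^ 2 := by positivity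
  simp only [RCLike.re_to_complex] at h3
  linarith

end WeakCompactness

theorem ennreal_le_liminf_add (u v : ℕ → ENNReal) :
    liminf u atTop + liminf v atTop ≤ liminf (fun n => u n + v n) atTop := by
  simp only [liminf_eq_iSup_iInf_of_nat]
  rw [ENNReal.iSup_add_iSup_of_monotone]
  · refine iSup_mono fun n => le_iInf₂ fun i hi => ?_
    exact add_le_add (iInf₂_le i hi) (iInf₂_le i hi)
  · exact fun n m h => le_iInf₂ fun i hi => iInf₂_le i (h.trans hi)
  · exact fun n m h => le_iInf₂ fun i hi => iInf₂_le i (h.trans hi)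

/-! ### Compactness in H¹ and existence of minimisers. -/

section DirectMethod

variable {ψ χ : ℝ → ℂ}

theorem norm_toLp_sq {f : ℝ → ℂ} (hf : MemLp f 2 sigma) :
    ‖hf.toLp f‖ ^ 2 = ∫ y, ‖f y‖ ^ 2 ∂sigma := by
  rw [← normLp_two_sq hf, Lp.norm_toLp, normLp]
  norm_num

theorem inner_toLp {f g : ℝ → ℂ} (hf : MemLp f 2 sigma) (hg : MemLp g 2 sigma) :
    inner ℂ (hf.toLp f) (hg.toLp g) = ∫ y, g y * conj (f y) ∂sigma := by
  rw [L2.inner_def]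
  refine integral_congr_ae ?_
  filter_upwards [hf.coeFn_toLp, hg.coeFn_toLp] with x h1 h2
  rw [h1, h2]
  rfl

/-- The variance of ‖f‖ under a probability measure is nonnegative. -/
theorem integral_norm_le_of_memLp {f : ℝ → ℂ} (hf : MemLp f 2 sigma) {R : ℝ} (hR : 0 ≤ R)
    (h : ∫ y, ‖f y‖ ^ 2 ∂sigma ≤ R ^ 2) : ∫ y, ‖f y‖ ∂sigma ≤ R := by
  have hi : Integrable f sigma := hf.integrable (by norm_num)
  have h2 := hf.integrable_norm_pow (p := 2) (by norm_num)
  by_contra! hlt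
  set m := ∫ y, ‖f y‖ ∂sigma
  have key : 0 ≤ ∫ y, (‖f y‖ - m) ^ 2 ∂sigma := integral_nonneg fun _ => sq_nonneg _
  have e : ∫ y, (‖f y‖ - m) ^ 2 ∂sigma = ∫ y, ‖f y‖ ^ 2 ∂sigma - m ^ 2 := by
    have : ∀ y, (‖f y‖ - m) ^ 2 = ‖f y‖ ^ 2 - 2 * m * ‖f y‖ + m ^ 2 := fun y => by ring
    simp only [this]
    have i1 : Integrable (fun y => 2 * m * ‖f y‖) sigma := hi.norm.const_mul _
    rw [integral_add (f := fun y => ‖f y‖ ^ 2 - 2 * m * ‖f y‖) (h2.sub i1) (integrable_const _),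
      integral_sub h2 i1, integral_const_mul,
      integral_const, probReal_univ, one_smul]
    ring
  nlinarith

/-- The value at any point is at most the value at `y` plus ∫|ψ'|; averaging over `y` gives the
bound. The factor 2π undoes the normalisation of `sigma`. -/
theorem MemH1.norm_le (h : MemH1 ψ) {A B : ℝ} (hB : 0 ≤ B) (hA : 0 ≤ A)
    (h1 : ∫ y, ‖ψ y‖ ^ 2 ∂sigma ≤ A ^ 2) (h2 : ∫ y, ‖deriv ψ y‖ ^ 2 ∂sigma ≤ B ^ 2) (x : ℝ) :
    ‖ψ x‖ ≤ A + 2 * Real.pi * B := by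
  have hpi := Real.two_pi_pos
  have hA' := integral_norm_le_of_memLp (h.memLp 2) hA h1
  have hB' := integral_norm_le_of_memLp h.memLp_deriv hB h2
  rw [integral_sigma, smul_eq_mul, inv_mul_le_iff₀ hpi] at hB'
  obtain ⟨z, hz, hxz⟩ := h.periodic.exists_mem_Ico₀ hpi x
  rw [hxz]
  have hd : ∀ y ∈ Ioc 0 (2 * Real.pi), ‖ψ z‖ ≤ ‖ψ y‖ + 2 * Real.pi * B := by
    intro y hy
    have e : ψ z = ψ y + ∫ t in y..z, deriv ψ t := by rw [h.locAC.integral_deriv]; ring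
    have hle : ‖∫ t in y..z, deriv ψ t‖ ≤ 2 * Real.pi * B := by
      refine le_trans intervalIntegral.norm_integral_le_integral_norm_uIoc ?_
      refine le_trans ?_ hB'
      rw [intervalIntegral.integral_of_le hpi.le]
      refine setIntegral_mono_set ?_ (Eventually.of_forall fun _ => norm_nonneg _) ?_
      · exact (h.intervalIntegrable_deriv 0 (2 * Real.pi)).1.norm
      · refine LE.le.eventuallyLE ?_
        rintro t ⟨ht1, ht2⟩
        refine ⟨lt_of_le_of_lt (le_min hy.1.le hz.1) ht1, ht2.trans (max_le hy.2 hz.2.le)⟩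
    rw [e]
    exact (norm_add_le _ _).trans (by gcongr)
  have hm : ∫ _y, ‖ψ z‖ ∂sigma ≤ ∫ y, (‖ψ y‖ + 2 * Real.pi * B) ∂sigma := by
    refine integral_mono_ae (integrable_const _) ?_ ?_
    · exact (integrable_sigma_of_continuous h.continuous).norm.add (integrable_const _)
    · change ∀ᵐ y ∂sigma, _
      rw [ae_sigma_iff]
      filter_upwards [ae_restrict_mem measurableSet_Ioc] with y hy using hd y hy
  rw [integral_add (integrable_sigma_of_continuous h.continuous).norm (integrable_const _)] at hm
  simp only [integral_const, probReal_univ, one_smul] at hm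
  linarith

/-- Primitives are pairings with indicator functions, so weak convergence of derivatives gives
pointwise convergence of primitives. -/
theorem intervalIntegral_eq_inner {f : ℝ → ℂ} (hf : MemLp f 2 sigma) {x : ℝ}
    (hx : x ∈ Icc 0 (2 * Real.pi)) :
    ∫ t in (0)..x, f t = 2 * Real.pi * conj (inner ℂ (hf.toLp f)
      (((memLp_const (1 : ℂ)).indicator (measurableSet_Ioc (a := (0 : ℝ)) (b := x)) :
        MemLp _ 2 sigma).toLp _)) := by
  have hpi := Real.two_pi_pos
  rw [inner_toLp, ← integral_conj, integral_sigma, intervalIntegral.integral_of_le hpi.le,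
    intervalIntegral.integral_of_le hx.1, Complex.real_smul]
  have : ∀ y, (starRingEnd ℂ) ((Ioc 0 x).indicator (fun _ => (1 : ℂ)) y * conj (f y)) =
      (Ioc 0 x).indicator f y := by
    intro y
    by_cases hy : y ∈ Ioc 0 x
    · simp [hy]
    · simp [hy]
  simp only [this]
  rw [setIntegral_indicator measurableSet_Ioc, inter_eq_self_of_subset_right
    (Ioc_subset_Ioc_right hx.2)]
  push_cast
  have : (2 * (Real.pi : ℂ)) ≠ 0 := by exact_mod_cast hpi.ne'
  field_simp

/-- Bounded sequences in `H¹` have subsequences that converge pointwise to a function in `H¹`, with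
weakly convergent magnetic derivatives. -/
theorem exists_subseq_tendsto_memH1 (a : ℝ) {u : ℕ → ℝ → ℂ} (hu : ∀ n, MemH1 (u n)) {M : ℝ}
    (h1 : ∀ n, ∫ y, ‖u n y‖ ^ 2 ∂sigma = 1) (h2 : ∀ n, ∫ y, ‖magDeriv a (u n) y‖ ^ 2 ∂sigma ≤ M) :
    ∃ (ψ : ℝ → ℂ) (φ : ℕ → ℕ) (C : ℝ), StrictMono φ ∧ MemH1 ψ ∧
      (∀ x, Tendsto (fun n => u (φ n) x) atTop (𝓝 (ψ x))) ∧ (∀ n x, ‖u n x‖ ≤ C) ∧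
      ∫ y, ‖ψ y‖ ^ 2 ∂sigma = 1 ∧
      ENNReal.ofReal (∫ y, ‖magDeriv a ψ y‖ ^ 2 ∂sigma) ≤
        liminf (fun n => ENNReal.ofReal (∫ y, ‖magDeriv a (u (φ n)) y‖ ^ 2 ∂sigma)) atTop := by
  have hpi := Real.two_pi_pos
  have hderiv : ∀ {ψ : ℝ → ℂ} (h : MemH1 ψ), (h.memLp_magDeriv a).toLp _ =
      h.memLp_deriv.toLp _ - (Complex.I * a) • (h.memLp 2).toLp _ := by
    intro ψ h
    rw [← MemLp.toLp_const_smul, ← MemLp.toLp_sub]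
    rfl
  have hg : ∀ n, ‖(hu n).memLp_deriv.toLp _‖ ≤ √M + |a| := by
    intro n
    have e : (hu n).memLp_deriv.toLp _ = ((hu n).memLp_magDeriv a).toLp _ +
      (Complex.I * a) • ((hu n).memLp 2).toLp _ := by
      rw [hderiv (hu n)]; abel
    rw [e]
    refine (norm_add_le _ _).trans (add_le_add ?_ ?_)
    · refine Real.le_sqrt_of_sq_le ?_
      rw [norm_toLp_sq]
      exact h2 n
    · rw [norm_smul]
      have : ‖((hu n).memLp 2).toLp (u n)‖ = 1 := by
        rw [← sq_eq_sq₀ (norm_nonneg _) zero_le_one, norm_toLp_sq, h1 n, one_pow]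
      simp [this]
  have hR : 0 ≤ √M + |a| := by positivity
  have hbound : ∀ n x, ‖u n x‖ ≤ 1 + 2 * Real.pi * (√M + |a|) := fun n x =>
    (hu n).norm_le hR zero_le_one (by rw [h1, one_pow])
      (by rw [← norm_toLp_sq (hu n).memLp_deriv]; exact pow_le_pow_left₀ (norm_nonneg _) (hg n) 2) x
  have : Fact ((2 : ENNReal) ≠ ⊤) := ⟨by norm_num⟩
  obtain ⟨G, φ₁, hφ₁, hG⟩ := exists_subseq_tendsto_inner _ _ hg
  -- The derivatives determine the functions up to a constant; this second extraction makes the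
  -- values at 0 converge.
  obtain ⟨c, -, φ₂, hφ₂, hc⟩ := tendsto_subseq_of_bounded
    (Metric.isBounded_closedBall (x := (0 : ℂ)) (r := 1 + 2 * Real.pi * (√M + |a|)))
    (x := fun n => u (φ₁ n) 0) (fun n => by simpa using hbound (φ₁ n) 0)
  have hGm : MemLp (G : ℝ → ℂ) 2 sigma := Lp.memLp G
  have hGe : hGm.toLp G = G := Lp.toLp_coeFn G hGm
  have hlim : ∀ x ∈ Icc 0 (2 * Real.pi), Tendsto (fun n => u (φ₁ (φ₂ n)) x) atTop
      (𝓝 (c + ∫ t in (0)..x, G t)) := by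
    intro x hx
    have e : ∀ n, u (φ₁ (φ₂ n)) x = u (φ₁ (φ₂ n)) 0 + ∫ t in (0)..x, deriv (u (φ₁ (φ₂ n))) t := by
      intro n
      rw [(hu _).locAC.integral_deriv]
      ring
    simp only [e]
    refine hc.add ?_
    rw [intervalIntegral_eq_inner hGm hx, hGe]
    simp only [intervalIntegral_eq_inner (hu _).memLp_deriv hx]
    refine Tendsto.const_mul _ ?_
    exact (Complex.continuous_conj.tendsto _).comp ((hG _).comp hφ₂.tendsto_atTop)
  have hex : ∀ x, ∃ l, Tendsto (fun n => u (φ₁ (φ₂ n)) x) atTop (𝓝 l) := by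
    intro x
    set k := toIcoDiv hpi 0 x
    have hk := toIcoMod_mem_Ico' hpi x
    refine ⟨_, (hlim _ (Ico_subset_Icc_self hk)).congr fun n => ?_⟩
    rw [toIcoMod, (hu _).periodic.sub_zsmul_eq]
  choose ψ hψ using hex
  have hper : Function.Periodic ψ (2 * Real.pi) := fun x =>
    tendsto_nhds_unique (hψ (x + 2 * Real.pi)) ((hψ x).congr fun n => ((hu _).periodic x).symm)
  have hprim : ∀ x ∈ Icc 0 (2 * Real.pi), ψ x = ψ 0 + ∫ t in (0)..x, G t := by
    intro x hx
    have h0 := tendsto_nhds_unique (hψ 0) (hlim 0 (left_mem_Icc.2 hpi.le))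
    rw [tendsto_nhds_unique (hψ x) (hlim x hx), h0]
    simp
  obtain ⟨hmem, hder⟩ := memH1_of_primitive hper hGm hprim
  set φ := φ₁ ∘ φ₂
  have hbψ : ∀ x, ‖ψ x‖ ≤ 1 + 2 * Real.pi * (√M + |a|) := fun x =>
    le_of_tendsto (hψ x).norm (Eventually.of_forall fun n => hbound _ x)
  have hnorm : ∫ y, ‖ψ y‖ ^ 2 ∂sigma = 1 := by
    have ht : Tendsto (fun n => ∫ y, ‖u (φ n) y‖ ^ 2 ∂sigma) atTop (𝓝 (∫ y, ‖ψ y‖ ^ 2 ∂sigma)) := by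
      refine tendsto_integral_of_dominated_convergence
        (fun _ => (1 + 2 * Real.pi * (√M + |a|)) ^ 2) ?_ (integrable_const _) ?_ ?_
      · exact fun n => ((hu _).continuous.norm.pow 2).aestronglyMeasurable
      · refine fun n => Eventually.of_forall fun x => ?_
        rw [Real.norm_of_nonneg (by positivity)]
        exact pow_le_pow_left₀ (norm_nonneg _) (hbound _ _) 2
      · exact Eventually.of_forall fun x => (hψ x).norm.pow 2
    simp only [h1] at ht
    exact tendsto_nhds_unique ht tendsto_const_nhds
  refine ⟨ψ, φ, _, hφ₁.comp hφ₂, hmem, hψ, hbound, hnorm, ?_⟩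
  have hweak : Tendsto (fun n => inner ℂ (((hu (φ n)).memLp_magDeriv a).toLp _)
      ((hmem.memLp_magDeriv a).toLp _)) atTop (𝓝 (inner ℂ ((hmem.memLp_magDeriv a).toLp _)
      ((hmem.memLp_magDeriv a).toLp _))) := by
    have hd := fun n => hderiv (hu (φ n))
    have hGd : hmem.memLp_deriv.toLp _ = G := by
      rw [← hGe]
      exact MemLp.toLp_congr _ _ hder
    have key : ∀ h : Lp ℂ 2 sigma, Tendsto (fun n => inner ℂ (((hu (φ n)).memLp_magDeriv a).toLp _)
        h) atTop (𝓝 (inner ℂ ((hmem.memLp_magDeriv a).toLp _) h)) := by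
      intro h
      simp only [hd, hderiv hmem, inner_sub_left, inner_smul_left, hGd]
      refine ((hG h).comp hφ₂.tendsto_atTop).sub (Tendsto.const_mul _ ?_)
      have hh : h = (Lp.memLp h).toLp h := (Lp.toLp_coeFn h _).symm
      rw [hh]
      simp only [inner_toLp]
      refine tendsto_integral_of_dominated_convergence
        (fun y => ‖h y‖ * (1 + 2 * Real.pi * (√M + |a|))) ?_ ?_ ?_ ?_
      · intro n
        exact (Lp.memLp h).1.mul
          (Complex.continuous_conj.comp (hu _).continuous).aestronglyMeasurable
      · exact ((Lp.memLp h).integrable (by norm_num)).norm.mul_const _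
      · refine fun n => Eventually.of_forall fun x => ?_
        rw [norm_mul, RCLike.norm_conj]
        exact mul_le_mul_of_nonneg_left (hbound _ _) (norm_nonneg _)
      · exact Eventually.of_forall fun x =>
          ((Complex.continuous_conj.tendsto _).comp (hψ x)).const_mul _
    exact key _
  have := le_liminf_norm_sq_of_tendsto_inner hweak
  simpa only [norm_toLp_sq] using this

/-- The direct method of the calculus of variations on the unit sphere of `L²`. -/
theorem exists_minimizer (a : ℝ) (V : (ℝ → ℂ) → ENNReal)
    (hV : ∀ (u : ℕ → ℝ → ℂ) (ψ : ℝ → ℂ) (C : ℝ), (∀ n, MemH1 (u n)) → MemH1 ψ →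
      (∀ x, Tendsto (fun n => u n x) atTop (𝓝 (ψ x))) → (∀ n x, ‖u n x‖ ≤ C) →
      V ψ ≤ liminf (fun n => V (u n)) atTop)
    (hfin : ∃ ψ, MemH1 ψ ∧ ∫ y, ‖ψ y‖ ^ 2 ∂sigma = 1 ∧ V ψ ≠ ⊤) :
    ∃ ψ, MemH1 ψ ∧ ∫ y, ‖ψ y‖ ^ 2 ∂sigma = 1 ∧ V ψ ≠ ⊤ ∧
      ∀ χ, MemH1 χ → ∫ y, ‖χ y‖ ^ 2 ∂sigma = 1 →
        ENNReal.ofReal (∫ y, ‖magDeriv a ψ y‖ ^ 2 ∂sigma) + V ψ ≤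
          ENNReal.ofReal (∫ y, ‖magDeriv a χ y‖ ^ 2 ∂sigma) + V χ := by
  obtain ⟨ψ₀, h₀, hn₀, hV₀⟩ := hfin
  set F : (ℝ → ℂ) → ENNReal := fun ψ =>
    ENNReal.ofReal (∫ y, ‖magDeriv a ψ y‖ ^ 2 ∂sigma) + V ψ with hF
  have hF₀ : F ψ₀ ≠ ⊤ := ENNReal.add_ne_top.2 ⟨ENNReal.ofReal_ne_top, hV₀⟩
  -- Only competitors no worse than `ψ₀` are kept, so every minimising sequence automatically has
  -- bounded kinetic energy.
  set S : Set ENNReal := {v | ∃ ψ, MemH1 ψ ∧ ∫ y, ‖ψ y‖ ^ 2 ∂sigma = 1 ∧ F ψ = v ∧ v ≤ F ψ₀}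
  obtain ⟨v, -, hv, hvS⟩ := exists_seq_tendsto_sInf (S := S) ⟨_, ψ₀, h₀, hn₀, rfl, le_rfl⟩
    (OrderBot.bddBelow _)
  choose u hu hn hFu hle using hvS
  have hM : ∀ n, ∫ y, ‖magDeriv a (u n) y‖ ^ 2 ∂sigma ≤ (F ψ₀).toReal := by
    intro n
    refine (ENNReal.ofReal_le_iff_le_toReal hF₀).1 (le_trans ?_ (hle n))
    rw [← hFu n]
    exact le_self_add
  obtain ⟨ψ, φ, C, hφ, hψ, hlim, hC, hψn, hlsc⟩ := exists_subseq_tendsto_memH1 a hu hn hM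
  have hmin : F ψ ≤ sInf S := by
    have h1 := hV (fun n => u (φ n)) ψ C (fun n => hu _) hψ hlim fun n x => hC _ x
    have h2 : Tendsto (fun n => F (u (φ n))) atTop (𝓝 (sInf S)) := by
      simp only [hFu]
      exact hv.comp hφ.tendsto_atTop
    rw [← h2.liminf_eq]
    exact (add_le_add hlsc h1).trans (ennreal_le_liminf_add _ _)
  have hS₀ : sInf S ≤ F ψ₀ := sInf_le ⟨ψ₀, h₀, hn₀, rfl, le_rfl⟩
  refine ⟨ψ, hψ, hψn, ?_, fun χ hχ hχn => ?_⟩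
  · exact (ENNReal.add_ne_top.1 (ne_top_of_le_ne_top hF₀ (hmin.trans hS₀))).2
  · by_cases hc : F χ ≤ F ψ₀
    · exact hmin.trans (sInf_le ⟨χ, hχ, hχn, rfl, hc⟩)
    · exact (hmin.trans hS₀).trans (not_le.1 hc).le

end DirectMethod

/-! ### The variational characterisation of the lowest eigenvalue, and Hölder's inequality for the
potential. -/

section QuadraticForm

variable {ψ χ : ℝ → ℂ} {φ : ℝ → ℝ} {a : ℝ}

/-- The quadratic form of `-(∂_y - i a)² + φ`. -/
def energy (a : ℝ) (φ : ℝ → ℝ) (ψ : ℝ → ℂ) : ℝ :=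
  ∫ y, ‖magDeriv a ψ y‖ ^ 2 ∂sigma + ∫ y, φ y * ‖ψ y‖ ^ 2 ∂sigma

theorem integrable_weight_mul_conj {w : ℝ → ℝ} {f g : ℝ → ℂ}
    (hw : AEStronglyMeasurable w sigma) (hw0 : ∀ᵐ y ∂sigma, 0 ≤ w y)
    (hf : AEStronglyMeasurable f sigma) (hg : AEStronglyMeasurable g sigma)
    (hwf : Integrable (fun y => w y * ‖f y‖ ^ 2) sigma)
    (hwg : Integrable (fun y => w y * ‖g y‖ ^ 2) sigma) :
    Integrable (fun y => (w y : ℂ) * (f y * conj (g y))) sigma := by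
  refine (hwf.add hwg).mono' ?_ ?_
  · exact (Complex.continuous_ofReal.comp_aestronglyMeasurable hw).mul
      (hf.mul (Complex.continuous_conj.comp_aestronglyMeasurable hg))
  · filter_upwards [hw0] with y hy
    simp only [norm_mul, Complex.norm_real, RCLike.norm_conj, Real.norm_of_nonneg hy, Pi.add_apply]
    nlinarith [sq_nonneg (‖f y‖ - ‖g y‖), mul_nonneg hy (sq_nonneg (‖f y‖ - ‖g y‖)),
      mul_nonneg hy (mul_nonneg (norm_nonneg (f y)) (norm_nonneg (g y)))]

theorem norm_add_mul_sq (t z v : ℂ) :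
    ‖z + t * v‖ ^ 2 = ‖z‖ ^ 2 + 2 * (conj t * (z * conj v)).re + ‖t‖ ^ 2 * ‖v‖ ^ 2 := by
  simp only [← Complex.normSq_eq_norm_sq, Complex.normSq_apply, Complex.mul_re, Complex.mul_im,
    Complex.add_re, Complex.add_im, Complex.conj_re, Complex.conj_im]
  ring

theorem integral_weight_norm_add_sq {w : ℝ → ℝ} {f g : ℝ → ℂ}
    (hwf : Integrable (fun y => w y * ‖f y‖ ^ 2) sigma)
    (hwg : Integrable (fun y => w y * ‖g y‖ ^ 2) sigma)
    (hfg : Integrable (fun y => (w y : ℂ) * (f y * conj (g y))) sigma) (t : ℂ) :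
    Integrable (fun y => w y * ‖f y + t * g y‖ ^ 2) sigma ∧
    ∫ y, w y * ‖f y + t * g y‖ ^ 2 ∂sigma = ∫ y, w y * ‖f y‖ ^ 2 ∂sigma +
      2 * (conj t * ∫ y, (w y : ℂ) * (f y * conj (g y)) ∂sigma).re +
      ‖t‖ ^ 2 * ∫ y, w y * ‖g y‖ ^ 2 ∂sigma := by
  have e : ∀ y, w y * ‖f y + t * g y‖ ^ 2 = w y * ‖f y‖ ^ 2 +
      2 * (conj t * ((w y : ℂ) * (f y * conj (g y)))).re + ‖t‖ ^ 2 * (w y * ‖g y‖ ^ 2) := by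
    intro y
    rw [norm_add_mul_sq, show conj t * ((w y : ℂ) * (f y * conj (g y))) =
      (w y : ℂ) * (conj t * (f y * conj (g y))) by ring, Complex.re_ofReal_mul]
    ring
  have i1 : Integrable (fun y => 2 * (conj t * ((w y : ℂ) * (f y * conj (g y)))).re) sigma :=
    (hfg.const_mul (conj t)).re.const_mul 2
  have i2 : Integrable (fun y => w y * ‖f y‖ ^ 2 +
      2 * (conj t * ((w y : ℂ) * (f y * conj (g y)))).re) sigma := hwf.add i1
  simp only [e]
  refine ⟨i2.add (hwg.const_mul _), ?_⟩
  have i3 : ∫ y, 2 * (conj t * ((w y : ℂ) * (f y * conj (g y)))).re ∂sigma =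
      2 * (conj t * ∫ y, (w y : ℂ) * (f y * conj (g y)) ∂sigma).re := by
    rw [integral_const_mul, ← integral_const_mul (conj t)]
    congr 1
    exact integral_re (hfg.const_mul (conj t))
  rw [integral_add i2 (hwg.const_mul _), integral_add hwf i1, i3, integral_const_mul]

theorem InFormDomain.integrable_mul_conj (hm : AEStronglyMeasurable φ sigma)
    (h0 : ∀ᵐ y ∂sigma, 0 ≤ φ y) (hψ : InFormDomain φ ψ) (hχ : InFormDomain φ χ) :
    Integrable (fun y => (φ y : ℂ) * (ψ y * conj (χ y))) sigma :=
  integrable_weight_mul_conj hm h0 hψ.1.continuous.aestronglyMeasurable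
    hχ.1.continuous.aestronglyMeasurable hψ.2 hχ.2

theorem InFormDomain.add_const_mul (hm : AEStronglyMeasurable φ sigma)
    (h0 : ∀ᵐ y ∂sigma, 0 ≤ φ y) (hψ : InFormDomain φ ψ) (hχ : InFormDomain φ χ) (t : ℂ) :
    InFormDomain φ (fun y => ψ y + t * χ y) :=
  ⟨hψ.1.add (hχ.1.const_mul t),
    (integral_weight_norm_add_sq hψ.2 hχ.2 (hψ.integrable_mul_conj hm h0 hχ) t).1⟩

theorem integral_norm_add_sq {f g : ℝ → ℂ} (hf : MemLp f 2 sigma) (hg : MemLp g 2 sigma) (t : ℂ) :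
    ∫ y, ‖f y + t * g y‖ ^ 2 ∂sigma = ∫ y, ‖f y‖ ^ 2 ∂sigma +
      2 * (conj t * ∫ y, f y * conj (g y) ∂sigma).re + ‖t‖ ^ 2 * ∫ y, ‖g y‖ ^ 2 ∂sigma := by
  have hf2 : Integrable (fun y => (1 : ℝ) * ‖f y‖ ^ 2) sigma := by
    simpa using hf.integrable_norm_pow (p := 2) (by norm_num)
  have hg2 : Integrable (fun y => (1 : ℝ) * ‖g y‖ ^ 2) sigma := by
    simpa using hg.integrable_norm_pow (p := 2) (by norm_num)
  have hfg := integrable_weight_mul_conj (w := fun _ => 1) aestronglyMeasurable_const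
    (Eventually.of_forall fun _ => zero_le_one) hf.1 hg.1 hf2 hg2
  simpa using (integral_weight_norm_add_sq hf2 hg2 hfg t).2

theorem energy_add_const_mul (hm : AEStronglyMeasurable φ sigma)
    (h0 : ∀ᵐ y ∂sigma, 0 ≤ φ y) (hψ : InFormDomain φ ψ) (hχ : InFormDomain φ χ) (t : ℂ) :
    energy a φ (fun y => ψ y + t * χ y) = energy a φ ψ + 2 * (conj t * magForm a φ ψ χ).re +
      ‖t‖ ^ 2 * energy a φ χ := by
  have h1 : ∫ y, ‖magDeriv a (fun y => ψ y + t * χ y) y‖ ^ 2 ∂sigma =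
      ∫ y, ‖magDeriv a ψ y + t * magDeriv a χ y‖ ^ 2 ∂sigma := by
    refine integral_congr_ae ?_
    filter_upwards [magDeriv_add hψ.1 (hχ.1.const_mul t) a] with y hy
    rw [hy, magDeriv_const_mul]
  rw [energy, h1, integral_norm_add_sq (hψ.1.memLp_magDeriv a) (hχ.1.memLp_magDeriv a) t,
    (integral_weight_norm_add_sq hψ.2 hχ.2 (hψ.integrable_mul_conj hm h0 hχ) t).2, energy, energy,
    magForm, mul_add (conj t), Complex.add_re]
  ring

/-- Minimisers of the Rayleigh quotient are eigenfunctions. -/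
theorem isApply_of_minimizer (hm : AEStronglyMeasurable φ sigma) (h0 : ∀ᵐ y ∂sigma, 0 ≤ φ y)
    (hψ : InFormDomain φ ψ) {e : ℝ} (he : energy a φ ψ = e * ∫ y, ‖ψ y‖ ^ 2 ∂sigma)
    (hmin : ∀ χ, InFormDomain φ χ → e * ∫ y, ‖χ y‖ ^ 2 ∂sigma ≤ energy a φ χ) :
    IsApply a φ ψ (fun y => (e : ℂ) * ψ y) := by
  refine ⟨hψ, (hψ.1.memLp 2).const_mul _, fun χ hχ => ?_⟩
  set B : ℂ := magForm a φ ψ χ - e * ∫ y, ψ y * conj (χ y) ∂sigma with hB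
  set q : ℝ := energy a φ χ - e * ∫ y, ‖χ y‖ ^ 2 ∂sigma with hq
  have key : ∀ t : ℂ, 0 ≤ 2 * (conj t * B).re + ‖t‖ ^ 2 * q := by
    intro t
    have := hmin _ (hψ.add_const_mul hm h0 hχ t)
    rw [energy_add_const_mul hm h0 hψ hχ, integral_norm_add_sq (hψ.1.memLp 2) (hχ.1.memLp 2) t,
      he] at this
    have e1 : (conj t * B).re = (conj t * magForm a φ ψ χ).re -
        e * (conj t * ∫ y, ψ y * conj (χ y) ∂sigma).re := by
      rw [hB, mul_sub, Complex.sub_re, ← Complex.re_ofReal_mul]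
      congr 2
      ring
    rw [e1, hq]
    linarith
  have hB0 : B = 0 := by
    by_contra hne
    have hb : 0 < ‖B‖ ^ 2 := by positivity
    -- The variation t = sB makes the linear term 2s‖B‖². For small negative s it beats the
    -- quadratic term, and s = -1/(|q| + 1) is small enough.
    have hs : ∀ s : ℝ, 0 ≤ 2 * s * ‖B‖ ^ 2 + s ^ 2 * ‖B‖ ^ 2 * q := by
      intro s
      have := key (s * B)
      rw [map_mul, Complex.conj_ofReal, mul_assoc, Complex.conj_mul', norm_mul, Complex.norm_real,
        mul_pow, Real.norm_eq_abs, sq_abs] at this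
      norm_cast at this
      linarith
    have h1 := hs (-(1 / (|q| + 1)))
    have hq1 : 0 < |q| + 1 := by positivity
    have h2 : 0 ≤ (-2 * (|q| + 1) + q) * ‖B‖ ^ 2 := by
      have : (-2 * (|q| + 1) + q) * ‖B‖ ^ 2 = (|q| + 1) ^ 2 * (2 * (-(1 / (|q| + 1))) * ‖B‖ ^ 2 +
          (-(1 / (|q| + 1))) ^ 2 * ‖B‖ ^ 2 * q) := by
        field_simp
      rw [this]
      positivity
    have h3 : -2 * (|q| + 1) + q < 0 := by
      have := le_abs_self q
      have := abs_nonneg q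
      linarith
    nlinarith
  have : ∫ y, ((e : ℂ) * ψ y) * conj (χ y) ∂sigma = e * ∫ y, ψ y * conj (χ y) ∂sigma := by
    rw [← integral_const_mul]
    simp only [mul_assoc]
  rw [this]
  exact sub_eq_zero.1 hB0

theorem IsApply.energy_eq {e : ℝ} (h : IsApply a φ ψ (fun y => (e : ℂ) * ψ y)) :
    energy a φ ψ = e * ∫ y, ‖ψ y‖ ^ 2 ∂sigma := by
  have h1 := h.2.2 ψ h.1
  have e1 : ∀ z : ℂ, z * conj z = ((‖z‖ ^ 2 : ℝ) : ℂ) := fun z => by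
    rw [Complex.mul_conj']
    norm_cast
  simp only [magForm, mul_assoc, e1] at h1
  norm_cast at h1
  rw [integral_const_mul] at h1
  norm_cast at h1

theorem MemH1.integral_norm_sq_pos (h : MemH1 ψ) (hne : ψ ≠ 0) : 0 < ∫ y, ‖ψ y‖ ^ 2 ∂sigma := by
  refine integral_pos_of_continuous (h.continuous.norm.pow 2) (fun _ => by positivity)
    (fun x => by simp only [h.periodic x]) ?_
  obtain ⟨x, hx⟩ := Function.ne_iff.1 hne
  exact ⟨x, pow_ne_zero 2 (norm_ne_zero_iff.2 hx)⟩

theorem energy_const_mul (c : ℂ) : energy a φ (fun y => c * ψ y) = ‖c‖ ^ 2 * energy a φ ψ := by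
  simp only [energy, magDeriv_const_mul, norm_mul, mul_pow, mul_left_comm (φ _)]
  rw [integral_const_mul, integral_const_mul]
  ring

theorem InFormDomain.const_mul (h : InFormDomain φ ψ) (c : ℂ) :
    InFormDomain φ (fun y => c * ψ y) := by
  refine ⟨h.1.const_mul c, ?_⟩
  simp only [norm_mul, mul_pow, mul_left_comm (φ _)]
  exact h.2.const_mul _

theorem integral_norm_const_mul_sq (c : ℂ) (f : ℝ → ℂ) :
    ∫ y, ‖c * f y‖ ^ 2 ∂sigma = ‖c‖ ^ 2 * ∫ y, ‖f y‖ ^ 2 ∂sigma := by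
  simp only [norm_mul, mul_pow]
  rw [integral_const_mul]

theorem MemH1.integral_normalize (h : MemH1 ψ) (hne : ψ ≠ 0) :
    ∃ c : ℂ, c ≠ 0 ∧ ∫ y, ‖c * ψ y‖ ^ 2 ∂sigma = 1 ∧
      ‖c‖ ^ 2 = (∫ y, ‖ψ y‖ ^ 2 ∂sigma)⁻¹ := by
  have hpos := h.integral_norm_sq_pos hne
  have hc : ‖((√(∫ y, ‖ψ y‖ ^ 2 ∂sigma))⁻¹ : ℂ)‖ ^ 2 = (∫ y, ‖ψ y‖ ^ 2 ∂sigma)⁻¹ := by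
    rw [norm_inv, Complex.norm_real, inv_pow, Real.norm_eq_abs, sq_abs, Real.sq_sqrt hpos.le]
  refine ⟨_, ?_, ?_, hc⟩
  · rw [ne_eq, inv_eq_zero, Complex.ofReal_eq_zero]
    exact (Real.sqrt_pos.2 hpos).ne'
  · rw [integral_norm_const_mul_sq, hc, inv_mul_cancel₀ hpos.ne']

/-- If the energy is bounded from below by `e` on the unit sphere, then so are the eigenvalues. -/
theorem le_of_mem_eigenvalues {e e' : ℝ} (he' : e' ∈ eigenvalues a φ)
    (h : ∀ χ, InFormDomain φ χ → e * ∫ y, ‖χ y‖ ^ 2 ∂sigma ≤ energy a φ χ) : e ≤ e' := by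
  obtain ⟨ψ, hne, hψ⟩ := he'
  have h1 := h ψ hψ.1
  rw [hψ.energy_eq] at h1
  exact le_of_mul_le_mul_right h1 (hψ.1.1.integral_norm_sq_pos hne)

/-- The homogeneous form of a lower bound for the energy on the unit sphere. -/
theorem mul_integral_le_energy {e : ℝ}
    (h : ∀ χ, InFormDomain φ χ → ∫ y, ‖χ y‖ ^ 2 ∂sigma = 1 → e ≤ energy a φ χ)
    (hχ : InFormDomain φ χ) : e * ∫ y, ‖χ y‖ ^ 2 ∂sigma ≤ energy a φ χ := by
  by_cases hne : χ = 0
  · subst hne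
    have : magDeriv a 0 = fun _ => 0 := by
      funext y
      simp [magDeriv]
    simp [energy, this]
  · obtain ⟨c, -, hc1, hc2⟩ := hχ.1.integral_normalize hne
    have := h _ (hχ.const_mul c) hc1
    rw [energy_const_mul, hc2] at this
    have hpos := hχ.1.integral_norm_sq_pos hne
    rw [le_inv_mul_iff₀ hpos] at this
    linarith

/-- An extended-valued potential energy encodes the form domain as its finiteness set, so the
minimisation can run over all of H¹ with Fatou's lemma. -/
theorem lintegral_potential_ne_top_iff (hm : AEStronglyMeasurable φ sigma)
    (h0 : ∀ᵐ y ∂sigma, 0 ≤ φ y) (h : MemH1 ψ) :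
    ∫⁻ y, ENNReal.ofReal (φ y * ‖ψ y‖ ^ 2) ∂sigma ≠ ⊤ ↔ InFormDomain φ ψ := by
  have hn : 0 ≤ᵐ[sigma] fun y => φ y * ‖ψ y‖ ^ 2 := by
    filter_upwards [h0] with y hy
    exact mul_nonneg hy (by positivity)
  have hmeas : AEStronglyMeasurable (fun y => φ y * ‖ψ y‖ ^ 2) sigma :=
    hm.mul (h.continuous.norm.pow 2).aestronglyMeasurable
  rw [← lt_top_iff_ne_top, ← hasFiniteIntegral_iff_ofReal hn]
  exact ⟨fun hf => ⟨h, hmeas, hf⟩, fun hf => hf.2.2⟩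

/-- The operator has a lowest eigenvalue, which is the minimum of the energy. -/
theorem exists_ground_state (a : ℝ) (hm : AEStronglyMeasurable φ sigma)
    (h0 : ∀ᵐ y ∂sigma, 0 ≤ φ y) (hne : ∃ ψ : ℝ → ℂ, ψ ≠ 0 ∧ InFormDomain φ ψ) :
    ∃ ψ, InFormDomain φ ψ ∧ ∫ y, ‖ψ y‖ ^ 2 ∂sigma = 1 ∧
      IsLeast (eigenvalues a φ) (energy a φ ψ) := by
  obtain ⟨ψ₀, hψ₀, hd₀⟩ := hne
  obtain ⟨c, -, hc, -⟩ := hd₀.1.integral_normalize hψ₀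
  have hV := fun (ψ : ℝ → ℂ) (h : MemH1 ψ) => lintegral_potential_ne_top_iff hm h0 h
  obtain ⟨ψ, hψ, hn, hfin, hmin⟩ := exists_minimizer a
    (fun ψ => ∫⁻ y, ENNReal.ofReal (φ y * ‖ψ y‖ ^ 2) ∂sigma)
    (by
      intro u ψ C hu hψ hlim hC
      have hle := lintegral_liminf_le' (μ := sigma) (u := atTop)
        (f := fun n y => ENNReal.ofReal (φ y * ‖u n y‖ ^ 2)) fun n =>
          (hm.aemeasurable.mul ((hu n).continuous.norm.pow 2).aemeasurable).ennreal_ofReal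
      refine le_trans (lintegral_mono fun y => ?_) hle
      have : Tendsto (fun n => ENNReal.ofReal (φ y * ‖u n y‖ ^ 2)) atTop
          (𝓝 (ENNReal.ofReal (φ y * ‖ψ y‖ ^ 2))) :=
        ENNReal.tendsto_ofReal (((hlim y).norm.pow 2).const_mul _)
      exact this.liminf_eq.ge)
    ⟨fun y => c * ψ₀ y, hd₀.1.const_mul c, hc, (hV _ (hd₀.1.const_mul c)).2 (hd₀.const_mul c)⟩
  have hψd := (hV ψ hψ).1 hfin
  have hnn : ∀ χ : ℝ → ℂ, 0 ≤ᵐ[sigma] fun y => φ y * ‖χ y‖ ^ 2 := fun χ => by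
    filter_upwards [h0] with y hy
    exact mul_nonneg hy (by positivity)
  have hE : ∀ χ, InFormDomain φ χ → ENNReal.ofReal (energy a φ χ) =
      ENNReal.ofReal (∫ y, ‖magDeriv a χ y‖ ^ 2 ∂sigma) +
        ∫⁻ y, ENNReal.ofReal (φ y * ‖χ y‖ ^ 2) ∂sigma := by
    intro χ hχ
    rw [energy, ENNReal.ofReal_add (integral_nonneg fun _ => by positivity)
      (integral_nonneg_of_ae (hnn χ)), ofReal_integral_eq_lintegral_ofReal hχ.2 (hnn χ)]
  have hlow : ∀ χ, InFormDomain φ χ → energy a φ ψ * ∫ y, ‖χ y‖ ^ 2 ∂sigma ≤ energy a φ χ := by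
    intro χ hχ
    refine mul_integral_le_energy (fun χ hχ h1 => ?_) hχ
    have := hmin χ hχ.1 h1
    rw [← hE χ hχ, ← hE ψ hψd] at this
    refine (ENNReal.ofReal_le_ofReal_iff ?_).1 this
    exact add_nonneg (integral_nonneg fun _ => by positivity) (integral_nonneg_of_ae (hnn χ))
  refine ⟨ψ, hψd, hn, ⟨ψ, ?_, isApply_of_minimizer hm h0 hψd (by rw [hn, mul_one]) hlow⟩,
    fun e' he' => le_of_mem_eigenvalues he' hlow⟩
  rintro rfl
  simp at hn

/-- Hölder's inequality between a potential and its inverse. -/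
theorem normLp_sq_le_mul_integral {p q : ℝ} (hp : p ∈ Ico (1 : ℝ) 2) (hq : q = p / (2 - p))
    (h0 : ∀ᵐ y ∂sigma, 0 < φ y) (hφ : MemLp (fun y => (φ y)⁻¹) (ENNReal.ofReal q) sigma)
    (hψ : InFormDomain φ ψ) :
    normLp p ψ ^ 2 ≤ normLp q (fun y => (φ y)⁻¹) * ∫ y, φ y * ‖ψ y‖ ^ 2 ∂sigma := by
  obtain ⟨hp1, hp2⟩ := hp
  have hp0 : 0 < p := by linarith
  have h2p : 0 < 2 - p := by linarith
  have hq0 : 0 < q := by rw [hq]; positivity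
  have hm : AEStronglyMeasurable φ sigma := by
    have := hφ.1.inv₀
    rwa [show (fun y => (φ y)⁻¹)⁻¹ = φ from funext fun y => inv_inv (φ y)] at this
  -- Hölder is applied to |ψ|^p = (φ|ψ|²)^{p/2} · (φ⁻¹)^{p/2}; the second exponent turns the second
  -- factor into φ^{-q}, since (p/2) · 2/(2 - p) = q.
  have hconj : (2 / p).HolderConjugate (2 / (2 - p)) := by
    rw [Real.holderConjugate_iff]
    refine ⟨by rw [lt_div_iff₀ hp0]; linarith, ?_⟩
    field_simp
    ring
  have hF : MemLp (fun y => (φ y * ‖ψ y‖ ^ 2) ^ (p / 2)) (ENNReal.ofReal (2 / p)) sigma := by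
    have := (memLp_one_iff_integrable.2 hψ.2).norm_rpow_div (ENNReal.ofReal (p / 2))
    rw [ENNReal.toReal_ofReal (by positivity), one_div, ← ENNReal.ofReal_inv_of_pos (by positivity),
      inv_div] at this
    refine this.ae_eq ?_
    filter_upwards [h0] with y hy
    rw [Real.norm_of_nonneg (by positivity)]
  have hG : MemLp (fun y => ((φ y)⁻¹) ^ (p / 2)) (ENNReal.ofReal (2 / (2 - p))) sigma := by
    have := hφ.norm_rpow_div (ENNReal.ofReal (p / 2))
    rw [ENNReal.toReal_ofReal (by positivity), ← ENNReal.ofReal_div_of_pos (by positivity),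
      hq, show p / (2 - p) / (p / 2) = 2 / (2 - p) by field_simp] at this
    refine this.ae_eq ?_
    filter_upwards [h0] with y hy
    rw [Real.norm_of_nonneg (by positivity)]
  have hold := integral_mul_le_Lp_mul_Lq_of_nonneg hconj
    (by filter_upwards [h0] with y hy; positivity) (by filter_upwards [h0] with y hy; positivity)
    hF hG
  have e1 : ∫ y, (φ y * ‖ψ y‖ ^ 2) ^ (p / 2) * ((φ y)⁻¹) ^ (p / 2) ∂sigma =
      ∫ y, ‖ψ y‖ ^ p ∂sigma := by
    refine integral_congr_ae ?_
    filter_upwards [h0] with y hy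
    rw [← Real.mul_rpow (by positivity) (by positivity), mul_right_comm, mul_inv_cancel₀ hy.ne',
      one_mul, ← Real.rpow_natCast, ← Real.rpow_mul (norm_nonneg _)]
    congr 1
    push_cast
    ring
  have e2 : ∫ y, ((φ y * ‖ψ y‖ ^ 2) ^ (p / 2)) ^ (2 / p) ∂sigma = ∫ y, φ y * ‖ψ y‖ ^ 2 ∂sigma := by
    refine integral_congr_ae ?_
    filter_upwards [h0] with y hy
    rw [← Real.rpow_mul (by positivity), show p / 2 * (2 / p) = 1 by field_simp, Real.rpow_one]
  have e3 : ∫ y, (((φ y)⁻¹) ^ (p / 2)) ^ (2 / (2 - p)) ∂sigma = ∫ y, ‖(φ y)⁻¹‖ ^ q ∂sigma := by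
    refine integral_congr_ae ?_
    filter_upwards [h0] with y hy
    rw [← Real.rpow_mul (by positivity), Real.norm_of_nonneg (by positivity), hq]
    congr 1
    field_simp
  rw [e1, e2, e3] at hold
  have hI1 : 0 ≤ ∫ y, φ y * ‖ψ y‖ ^ 2 ∂sigma :=
    integral_nonneg_of_ae (by filter_upwards [h0] with y hy; positivity)
  have hI2 : 0 ≤ ∫ y, ‖(φ y)⁻¹‖ ^ q ∂sigma := integral_nonneg fun _ => by positivity
  have hI3 : 0 ≤ ∫ y, ‖ψ y‖ ^ p ∂sigma := integral_nonneg fun _ => by positivity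
  rw [normLp_eq hp0 (hψ.1.memLp _), normLp_eq hq0 hφ, ← Real.rpow_natCast, ← Real.rpow_mul hI3]
  have := Real.rpow_le_rpow hI3 hold (show 0 ≤ p⁻¹ * ((2 : ℕ) : ℝ) by positivity)
  rw [Real.mul_rpow (by positivity) (by positivity), ← Real.rpow_mul hI1, ← Real.rpow_mul hI2,
    show 1 / (2 / p) * (p⁻¹ * ((2 : ℕ) : ℝ)) = 1 by push_cast; field_simp,
    show 1 / (2 / (2 - p)) * (p⁻¹ * ((2 : ℕ) : ℝ)) = q⁻¹ by rw [hq]; push_cast; field_simp,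
    Real.rpow_one] at this
  linarith

end QuadraticForm

/-! ### Wirtinger inequalities with Dirichlet and antiperiodic conditions. -/

section Wirtinger

/-- Wirtinger's inequality with Dirichlet boundary conditions. -/
theorem wirtinger_dirichlet {f : ℝ → ℝ} (hf : LocAC f) {b L : ℝ} (hL : 0 < L) (h0 : f b = 0)
    (h1 : f (b + L) = 0)
    (hi : IntervalIntegrable (fun x => deriv f x ^ 2) volume b (b + L)) :
    (Real.pi / L) ^ 2 * ∫ x in b..(b + L), f x ^ 2 ≤ ∫ x in b..(b + L), deriv f x ^ 2 := by
  have hbL : b ≤ b + L := by linarith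
  have hf2 : IntervalIntegrable (fun x => f x ^ 2) volume b (b + L) :=
    (hf.continuous.pow 2).intervalIntegrable _ _
  -- For α < π/L, a translate of sin(αx), centred on the interval, is positive up to the endpoints.
  -- Its logarithmic derivative `h` is then smooth there and solves the Riccati equation h' = -α² -
  -- h².
  have key : ∀ α ∈ Ioo 0 (Real.pi / L),
      α ^ 2 * ∫ x in b..(b + L), f x ^ 2 ≤ ∫ x in b..(b + L), deriv f x ^ 2 := by
    rintro α ⟨hα0, hα1⟩
    rw [lt_div_iff₀ hL] at hα1
    set ξ : ℝ → ℝ := fun x => α * (x - b) + (Real.pi - α * L) / 2 with hξ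
    set h : ℝ → ℝ := fun x => α * (Real.cos (ξ x) / Real.sin (ξ x)) with hh
    have hsin : ∀ x ∈ uIcc b (b + L), 0 < Real.sin (ξ x) := by
      intro x hx
      rw [uIcc_of_le hbL] at hx
      have h1 : 0 ≤ α * (x - b) := mul_nonneg hα0.le (by linarith [hx.1])
      have h2 : α * (x - b) ≤ α * L := mul_le_mul_of_nonneg_left (by linarith [hx.2]) hα0.le
      exact Real.sin_pos_of_pos_of_lt_pi (by simp only [hξ]; linarith) (by simp only [hξ]; linarith)
    have hξs : ContDiff ℝ 1 ξ := by fun_prop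
    have hac : AbsolutelyContinuousOnInterval h b (b + L) := by
      refine ContDiffOn.absolutelyContinuousOnInterval ?_
      refine contDiffOn_const.mul (ContDiffOn.div ?_ ?_ fun x hx => (hsin x hx).ne')
      · exact (Real.contDiff_cos.comp hξs).contDiffOn
      · exact (Real.contDiff_sin.comp hξs).contDiffOn
    have hder : ∀ x ∈ uIcc b (b + L), deriv h x = -α ^ 2 - h x ^ 2 := by
      intro x hx
      have hs := (hsin x hx).ne'
      have hξd : HasDerivAt ξ α x := by
        simpa [hξ] using (((hasDerivAt_id x).sub_const b).const_mul α).add_const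
          ((Real.pi - α * L) / 2)
      have hd := ((hξd.cos.fun_div hξd.sin hs).const_mul α).deriv
      rw [hh, hd]
      field_simp
    have hbp := hac.integral_deriv_mul_eq_sub ((hf.mul hf) b (b + L))
    simp only [h0, h1, mul_zero, sub_zero] at hbp
    -- By the Riccati equation, f'² - α²f² - (hf²)' is a perfect square, and (hf²)' integrates to
    -- zero because `f` vanishes at both ends.
    have hcong : ∀ᵐ x : ℝ, x ∈ uIoc b (b + L) →
        deriv f x ^ 2 - α ^ 2 * f x ^ 2 - (deriv h x * (f x * f x) +
          h x * deriv (fun x => f x * f x) x) = (deriv f x - h x * f x) ^ 2 := by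
      filter_upwards [hf.ae_differentiableAt] with x hx hmem
      rw [hder x (uIoc_subset_uIcc hmem), deriv_fun_mul hx hx]
      ring
    have hint : IntervalIntegrable (fun x => deriv h x * (f x * f x) +
        h x * deriv (fun x => f x * f x) x) volume b (b + L) := by
      refine IntervalIntegrable.add ?_ ?_
      · exact hac.intervalIntegrable_deriv.mul_continuousOn
          (hf.continuous.mul hf.continuous).continuousOn
      · exact ((hf.mul hf) b (b + L)).intervalIntegrable_deriv.continuousOn_mul hac.continuousOn
    have hpos : 0 ≤ ∫ x in b..(b + L), (deriv f x - h x * f x) ^ 2 :=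
      intervalIntegral.integral_nonneg hbL fun _ _ => sq_nonneg _
    rw [← intervalIntegral.integral_congr_ae hcong, intervalIntegral.integral_sub
      (hi.sub (hf2.const_mul _)) hint, hbp, intervalIntegral.integral_sub hi (hf2.const_mul _),
      intervalIntegral.integral_const_mul] at hpos
    linarith
  have hpos : 0 < Real.pi / L := div_pos Real.pi_pos hL
  have ht : Tendsto (fun α : ℝ => α ^ 2 * ∫ x in b..(b + L), f x ^ 2) (𝓝[<] (Real.pi / L))
      (𝓝 ((Real.pi / L) ^ 2 * ∫ x in b..(b + L), f x ^ 2)) :=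
    ((continuous_pow 2).mul continuous_const).continuousAt.tendsto.mono_left nhdsWithin_le_nhds
  exact le_of_tendsto ht (eventually_of_mem (Ioo_mem_nhdsLT hpos) key)

theorem wirtinger_of_zero {u : ℝ → ℝ} (hu : LocAC u) (hp : Function.Periodic u (2 * Real.pi))
    (hi : ∀ a b, IntervalIntegrable (fun x => deriv u x ^ 2) volume a b) {x₀ : ℝ} (h0 : u x₀ = 0) :
    (1 / 4) * ∫ x in (0)..(2 * Real.pi), u x ^ 2 ≤ ∫ x in (0)..(2 * Real.pi), deriv u x ^ 2 := by
  have h := wirtinger_dirichlet hu Real.two_pi_pos h0 (by rw [hp x₀, h0]) (hi _ _)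
  have e1 := Function.Periodic.intervalIntegral_add_eq (f := fun x => u x ^ 2)
    (T := 2 * Real.pi) (fun x => by simp only [hp x]) x₀ 0
  have e2 := Function.Periodic.intervalIntegral_add_eq (f := fun x => deriv u x ^ 2)
    (T := 2 * Real.pi) (fun x => by simp only [periodic_deriv hp x]) x₀ 0
  rw [e1, e2, zero_add, show Real.pi / (2 * Real.pi) = 1 / 2 by
    field_simp] at h
  norm_num at h ⊢
  exact h

/-- Wirtinger's inequality for the antiperiodic function of modulus `u` and constant current. -/
theorem wirtinger_of_pos {u : ℝ → ℝ} (hu : LocAC u) (hp : Function.Periodic u (2 * Real.pi))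
    (hi : ∀ a b, IntervalIntegrable (fun x => deriv u x ^ 2) volume a b) (hpos : ∀ x, 0 < u x) :
    (1 / 4) * ∫ x in (0)..(2 * Real.pi), u x ^ 2 ≤ (∫ x in (0)..(2 * Real.pi), deriv u x ^ 2) +
      Real.pi ^ 2 / ∫ x in (0)..(2 * Real.pi), (u x ^ 2)⁻¹ := by
  have hpi := Real.two_pi_pos
  have huc := hu.continuous
  have hw : Continuous fun x => (u x ^ 2)⁻¹ := (huc.pow 2).inv₀ fun x => (pow_pos (hpos x) 2).ne'
  have hwp : Function.Periodic (fun x => (u x ^ 2)⁻¹) (2 * Real.pi) := fun x => by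
    simp only [hp x]
  set S := ∫ x in (0)..(2 * Real.pi), (u x ^ 2)⁻¹ with hS
  have hS0 : 0 < S := intervalIntegral.intervalIntegral_pos_of_pos_on
    (hw.intervalIntegrable _ _) (fun x _ => inv_pos.2 (pow_pos (hpos x) 2)) hpi
  -- The phase η has constant current u²η' = π/S and increases by π over a period, so u·exp(iη) is
  -- antiperiodic. The base point `b` places a zero of u·sin η at `b`.
  set η : ℝ → ℝ → ℝ := fun b x => Real.pi / S * ∫ t in b..x, (u t ^ 2)⁻¹ with hη
  have hηd : ∀ b x, HasDerivAt (η b) (Real.pi / S * (u x ^ 2)⁻¹) x := fun b x =>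
    ((hw.integral_hasStrictDerivAt b x).hasDerivAt).const_mul _
  have hηs : ∀ b x, η b (x + 2 * Real.pi) = η b x + Real.pi := by
    intro b x
    simp only [hη]
    rw [← intervalIntegral.integral_add_adjacent_intervals (hw.intervalIntegrable b x)
      (hw.intervalIntegrable x _), hwp.intervalIntegral_add_eq x 0, zero_add, mul_add, ← hS,
      div_mul_cancel₀ _ hS0.ne']
  have hηC : ∀ b, ContDiff ℝ 1 (η b) := by
    intro b
    rw [contDiff_one_iff_deriv]
    refine ⟨fun x => (hηd b x).differentiableAt, ?_⟩
    rw [show deriv (η b) = fun x => Real.pi / S * (u x ^ 2)⁻¹ from funext fun x => (hηd b x).deriv]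
    exact continuous_const.mul hw
  set P : ℝ → ℝ → ℝ := fun b x => (deriv u x * Real.sin (η b x) +
    Real.pi / S * (u x)⁻¹ * Real.cos (η b x)) ^ 2 with hP
  set R : ℝ → ℝ → ℝ := fun b x => (u x * Real.sin (η b x)) ^ 2 with hR
  have hPi : ∀ b c d, IntervalIntegrable (P b) volume c d := by
    intro b c d
    have hs : Continuous fun x => Real.sin (η b x) := Real.continuous_sin.comp (hηC b).continuous
    have hc : Continuous fun x => Real.cos (η b x) := Real.continuous_cos.comp (hηC b).continuous
    have hui : Continuous fun x => (u x)⁻¹ := huc.inv₀ fun x => (hpos x).ne'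
    have e : P b = fun x => deriv u x ^ 2 * Real.sin (η b x) ^ 2 + (deriv u x *
        (2 * Real.sin (η b x) * (Real.pi / S * (u x)⁻¹ * Real.cos (η b x))) +
          (Real.pi / S * (u x)⁻¹ * Real.cos (η b x)) ^ 2) := by
      funext x
      simp only [hP]
      ring
    rw [e]
    have hcc : Continuous fun x => Real.pi / S * (u x)⁻¹ * Real.cos (η b x) :=
      (continuous_const.mul hui).mul hc
    refine ((hi c d).mul_continuousOn (hs.pow 2).continuousOn).add (IntervalIntegrable.add ?_ ?_)
    · exact (hu c d).intervalIntegrable_deriv.mul_continuousOn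
        ((continuous_const.mul hs).mul hcc).continuousOn
    · exact (hcc.pow 2).intervalIntegrable _ _
  have hRc : ∀ b, Continuous (R b) := fun b =>
    (huc.mul (Real.continuous_sin.comp (hηC b).continuous)).pow 2
  have hb : ∀ b, (1 / 4) * ∫ x in (0)..(2 * Real.pi), R b x ≤
      ∫ x in (0)..(2 * Real.pi), P b x := by
    intro b
    set f : ℝ → ℝ := fun x => u x * Real.sin (η b x) with hf
    have hfac : LocAC f := hu.mul (locAC_of_contDiff (Real.contDiff_sin.comp (hηC b)))
    have hd : ∀ᵐ x : ℝ, deriv f x ^ 2 = P b x := by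
      filter_upwards [hu.ae_differentiableAt] with x hx
      have := (hx.hasDerivAt.fun_mul (hηd b x).sin).deriv
      rw [hf, this]
      simp only [hP]
      have := (hpos x).ne'
      field_simp
    have hηb : η b b = 0 := by simp [hη]
    have h := wirtinger_dirichlet hfac (b := b) hpi (by simp [hf, hηb])
      (by simp [hf, hηs, hηb]) ((hPi b _ _).congr_ae
        (ae_restrict_of_ae (hd.mono fun _ h => h.symm)))
    rw [intervalIntegral.integral_congr_ae (hd.mono fun _ h _ => h),
      show Real.pi / (2 * Real.pi) = 1 / 2 by field_simp] at h
    -- Sine and cosine change sign under the shift by π; their combinations in `R b` and `P b` are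
    -- squared, hence periodic, and the integrals move to [0, 2π].
    have e1 := Function.Periodic.intervalIntegral_add_eq (f := R b) (T := 2 * Real.pi)
      (fun x => by simp only [hR, hp x, hηs, Real.sin_add_pi]; ring) b 0
    have e2 := Function.Periodic.intervalIntegral_add_eq (f := P b) (T := 2 * Real.pi)
      (fun x => by
        simp only [hP, hp x, periodic_deriv hp x, hηs, Real.sin_add_pi, Real.cos_add_pi]; ring) b 0
    change (1 / 2) ^ 2 * ∫ x in b..(b + 2 * Real.pi), R b x ≤ _ at h
    rw [e1, e2, zero_add] at h
    norm_num at h ⊢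
    exact h
  have hη0 : η 0 0 = 0 := by simp [hη]
  -- Restarting the phase where it equals π/2 turns the sine into minus the cosine. The two
  -- Dirichlet inequalities thus treat both components of u·exp(iη), and their sum involves only u
  -- and u'.
  obtain ⟨x₀, -, hx₀⟩ := intermediate_value_Icc hpi.le ((hηC 0).continuous.continuousOn)
    (show Real.pi / 2 ∈ Icc (η 0 0) (η 0 (2 * Real.pi)) by
      have := hηs 0 0
      rw [zero_add, hη0, zero_add] at this
      rw [hη0, this]
      constructor <;> linarith [Real.pi_pos])
  have hshift : ∀ x, η x₀ x = η 0 x - Real.pi / 2 := by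
    intro x
    rw [← hx₀]
    simp only [hη]
    rw [← mul_sub, intervalIntegral.integral_interval_sub_left (hw.intervalIntegrable _ _)
      (hw.intervalIntegrable _ _)]
  have hsum := add_le_add (hb 0) (hb x₀)
  rw [← mul_add, ← intervalIntegral.integral_add ((hRc 0).intervalIntegrable _ _)
    ((hRc x₀).intervalIntegrable _ _), ← intervalIntegral.integral_add (hPi _ _ _) (hPi _ _ _)]
    at hsum
  have eR : ∀ x, R 0 x + R x₀ x = u x ^ 2 := by
    intro x
    simp only [hR, hshift, Real.sin_sub_pi_div_two]
    linear_combination u x ^ 2 * Real.sin_sq_add_cos_sq (η 0 x)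
  have eP : ∀ x, P 0 x + P x₀ x = deriv u x ^ 2 + (Real.pi / S) ^ 2 * (u x ^ 2)⁻¹ := by
    intro x
    simp only [hP, hshift, Real.sin_sub_pi_div_two, Real.cos_sub_pi_div_two]
    rw [← inv_pow]
    linear_combination (deriv u x ^ 2 + (Real.pi / S) ^ 2 * (u x)⁻¹ ^ 2) *
      Real.sin_sq_add_cos_sq (η 0 x)
  simp only [eR, eP] at hsum
  rw [intervalIntegral.integral_add (hi _ _) ((hw.intervalIntegrable _ _).const_mul _),
    intervalIntegral.integral_const_mul, ← hS] at hsum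
  have : (Real.pi / S) ^ 2 * S = Real.pi ^ 2 / S := by field_simp
  rwa [this] at hsum

end Wirtinger

/-! ### Winding numbers and the improved diamagnetic inequality. -/

section MagneticLowerBound

variable {ψ : ℝ → ℂ}

/-- The winding number of a nowhere vanishing function is an integer. -/
theorem MemH1.exists_winding (h : MemH1 ψ) (hne : ∀ x, ψ x ≠ 0) :
    ∃ k : ℤ, ∫ x in (0)..(2 * Real.pi), (deriv ψ x / ψ x).im = 2 * Real.pi * k := by
  have hinv : Continuous fun x => (ψ x)⁻¹ := h.continuous.inv₀ hne
  have hi : ∀ a b, IntervalIntegrable (fun x => deriv ψ x / ψ x) volume a b := fun a b => by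
    simpa only [div_eq_mul_inv] using
      (h.intervalIntegrable_deriv a b).mul_continuousOn hinv.continuousOn
  set W : ℝ → ℂ := fun x => ∫ t in (0)..x, deriv ψ t / ψ t with hW
  -- Since W' = ψ'/ψ almost everywhere, this product is constant. Periodicity of `ψ` then gives
  -- exp(-W(2π)) = 1.
  have hE : LocAC fun x => Complex.exp (-W x) * ψ x :=
    ((locAC_integral hi 0).comp_contDiff (g := fun z => Complex.exp (-z))
      (by fun_prop)).mul h.locAC
  have hd : ∀ᵐ x : ℝ, HasDerivAt (fun x => Complex.exp (-W x) * ψ x) 0 x := by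
    filter_upwards [h.locAC.ae_differentiableAt,
      LocallyIntegrable.ae_hasDerivAt_integral (locallyIntegrable_of_intervalIntegrable hi)]
      with x h1 h2
    have := ((h2 0).fun_neg.cexp).fun_mul h1.hasDerivAt
    rwa [mul_assoc, neg_mul, div_mul_cancel₀ _ (hne x), mul_neg, neg_add_cancel] at this
  have hc := hE.eq_of_deriv_eq_zero hd (2 * Real.pi) 0
  have hper : ψ (2 * Real.pi) = ψ 0 := by simpa using h.periodic 0
  have hW0 : W 0 = 0 := by simp [hW]
  rw [hper, hW0, neg_zero, Complex.exp_zero] at hc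
  have h1 := mul_right_cancel₀ (hne 0) hc
  obtain ⟨n, hn⟩ := Complex.exp_eq_one_iff.1 h1
  refine ⟨-n, ?_⟩
  rw [← intervalIntegral_im (hi _ _)]
  have : W (2 * Real.pi) = -(n * (2 * Real.pi * Complex.I)) := by rw [← hn, neg_neg]
  change (W (2 * Real.pi)).im = _
  rw [this]
  simp
  ring

/-- Polar decomposition without choosing a phase: the real part of ψ'/ψ is |ψ|'/|ψ|, and the
imaginary part plays the role of the phase derivative. -/
theorem norm_magDeriv_sq {x a : ℝ} (h : DifferentiableAt ℝ ψ x)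
    (hn : DifferentiableAt ℝ (fun x => ‖ψ x‖) x) (h0 : ψ x ≠ 0) :
    ‖magDeriv a ψ x‖ ^ 2 = deriv (fun x => ‖ψ x‖) x ^ 2 +
      ‖ψ x‖ ^ 2 * ((deriv ψ x / ψ x).im - a) ^ 2 := by
  have hpos : 0 < ‖ψ x‖ := norm_pos_iff.2 h0
  set z := deriv ψ x / ψ x with hz
  have hd : deriv ψ x = z * ψ x := by rw [hz, div_mul_cancel₀ _ h0]
  have h1 : deriv (fun x => ‖ψ x‖) x = z.re * ‖ψ x‖ := by
    have := norm_mul_deriv_norm h hn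
    rw [hd, show conj (ψ x) * (z * ψ x) = z * (conj (ψ x) * ψ x) by ring, Complex.conj_mul',
      ← Complex.ofReal_pow, Complex.re_mul_ofReal] at this
    have h2 : ‖ψ x‖ * deriv (fun x => ‖ψ x‖) x = ‖ψ x‖ * (z.re * ‖ψ x‖) := by rw [this]; ring
    exact mul_left_cancel₀ hpos.ne' h2
  rw [h1, magDeriv, hd, show z * ψ x - Complex.I * a * ψ x = (z - Complex.I * a) * ψ x by ring,
    norm_mul, mul_pow, ← Complex.normSq_eq_norm_sq, Complex.normSq_apply]
  simp
  ring

theorem intervalIntegrable_of_integrable_sigma {E : Type*} [NormedAddCommGroup E] {f : ℝ → E}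
    (hp : Function.Periodic f (2 * Real.pi)) (hf : Integrable f sigma) (a b : ℝ) :
    IntervalIntegrable f volume a b :=
  hp.intervalIntegrable₀ Real.two_pi_pos.ne' (integrable_sigma_iff.1 hf) a b

/-- A lower bound for the magnetic energy which improves on the diamagnetic inequality. -/
theorem MemH1.magnetic_lower_bound (h : MemH1 ψ) {a : ℝ} (ha : a ∈ Icc (0 : ℝ) (1 / 2)) :
    a ^ 2 * ∫ y, ‖ψ y‖ ^ 2 ∂sigma +
      (1 - 4 * a ^ 2) * ∫ y, deriv (fun x => ‖ψ x‖) y ^ 2 ∂sigma ≤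
      ∫ y, ‖magDeriv a ψ y‖ ^ 2 ∂sigma := by
  have hpi := Real.two_pi_pos
  set u : ℝ → ℝ := fun x => ‖ψ x‖ with hu
  have hup : Function.Periodic u (2 * Real.pi) := fun x => by simp only [hu, h.periodic x]
  have huac : LocAC u := h.locAC.norm
  have hdi : Integrable (fun x => deriv u x ^ 2) sigma := by
    simpa using h.memLp_deriv_norm.integrable_norm_pow (p := 2) (by norm_num)
  have hi : ∀ a b, IntervalIntegrable (fun x => deriv u x ^ 2) volume a b :=
    intervalIntegrable_of_integrable_sigma (fun x => by simp only [periodic_deriv hup x]) hdi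
  by_cases hz : ∃ x₀, ψ x₀ = 0
  · obtain ⟨x₀, hx₀⟩ := hz
    have h1 := wirtinger_of_zero huac hup hi (x₀ := x₀) (by simp [hu, hx₀])
    have h2 : (1 / 4) * ∫ y, ‖ψ y‖ ^ 2 ∂sigma ≤ ∫ y, deriv u y ^ 2 ∂sigma := by
      rw [integral_sigma, integral_sigma, smul_eq_mul, smul_eq_mul, mul_left_comm]
      exact mul_le_mul_of_nonneg_left h1 (inv_nonneg.2 hpi.le)
    have h3 := h.integral_deriv_norm_sq_le a
    -- Split ∫u'² with weights 1 - 4a² and 4a², and use ∫u² ≤ 4∫u'² on the second piece.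
    nlinarith [sq_nonneg a]
  · push Not at hz
    have hpos : ∀ x, 0 < u x := fun x => norm_pos_iff.2 (hz x)
    have h1 := wirtinger_of_pos huac hup hi hpos
    obtain ⟨k, hk⟩ := h.exists_winding hz
    set S := ∫ x in (0)..(2 * Real.pi), (u x ^ 2)⁻¹ with hS
    have hw : Continuous fun x => (u x ^ 2)⁻¹ :=
      (huac.continuous.pow 2).inv₀ fun x => (pow_pos (hpos x) 2).ne'
    have hS0 : 0 < S := intervalIntegral.intervalIntegral_pos_of_pos_on
      (hw.intervalIntegrable _ _) (fun x _ => inv_pos.2 (pow_pos (hpos x) 2)) hpi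
    have hji : IntervalIntegrable (fun x => (deriv ψ x / ψ x).im) volume 0 (2 * Real.pi) := by
      have hinv : Continuous fun x => (ψ x)⁻¹ := h.continuous.inv₀ hz
      have : IntervalIntegrable (fun x => deriv ψ x / ψ x) volume 0 (2 * Real.pi) := by
        simpa only [div_eq_mul_inv] using
          (h.intervalIntegrable_deriv _ _).mul_continuousOn hinv.continuousOn
      exact ⟨this.1.im, this.2.im⟩
    -- This is Cauchy–Schwarz in linearised form: with j the phase derivative minus a, u²j² ≥ 2lj -
    -- l²u⁻² for every l. As ∫j = 2π(k - a), this l maximises the integrated right side.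
    set l : ℝ := 2 * Real.pi * (k - a) / S with hl
    have hmi : IntervalIntegrable (fun x => ‖magDeriv a ψ x‖ ^ 2) volume 0 (2 * Real.pi) :=
      integrable_sigma_iff.1 ((h.memLp_magDeriv a).integrable_norm_pow (by norm_num))
    have hli : IntervalIntegrable (fun x => deriv u x ^ 2 + (2 * l * ((deriv ψ x / ψ x).im - a) -
        l ^ 2 * (u x ^ 2)⁻¹)) volume 0 (2 * Real.pi) :=
      (hi _ _).add (((hji.sub intervalIntegrable_const).const_mul _).sub
        ((hw.intervalIntegrable _ _).const_mul _))
    have hmono : ∫ x in (0)..(2 * Real.pi), (deriv u x ^ 2 + (2 * l * ((deriv ψ x / ψ x).im - a) -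
        l ^ 2 * (u x ^ 2)⁻¹)) ≤ ∫ x in (0)..(2 * Real.pi), ‖magDeriv a ψ x‖ ^ 2 := by
      refine intervalIntegral.integral_mono_ae hpi.le hli hmi ?_
      filter_upwards [h.locAC.ae_differentiableAt, huac.ae_differentiableAt] with x hx1 hx2
      rw [norm_magDeriv_sq hx1 hx2 (hz x)]
      have hux : ‖ψ x‖ = u x := rfl
      rw [hux]
      have hx := (hpos x).ne'
      have e : u x ^ 2 * ((deriv ψ x / ψ x).im - a) ^ 2 -
          (2 * l * ((deriv ψ x / ψ x).im - a) - l ^ 2 * (u x ^ 2)⁻¹) =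
          (u x * ((deriv ψ x / ψ x).im - a) - l * (u x)⁻¹) ^ 2 := by
        field_simp
        ring
      have := sq_nonneg (u x * ((deriv ψ x / ψ x).im - a) - l * (u x)⁻¹)
      change deriv u x ^ 2 + _ ≤ deriv u x ^ 2 + _
      linarith
    rw [intervalIntegral.integral_add (hi _ _) (((hji.sub intervalIntegrable_const).const_mul
      _).sub ((hw.intervalIntegrable _ _).const_mul _)), intervalIntegral.integral_sub
      ((hji.sub intervalIntegrable_const).const_mul _) ((hw.intervalIntegrable _ _).const_mul _),
      intervalIntegral.integral_const_mul, intervalIntegral.integral_const_mul,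
      intervalIntegral.integral_sub hji intervalIntegrable_const, hk, ← hS,
      intervalIntegral.integral_const, smul_eq_mul, sub_zero] at hmono
    have e1 : 2 * l * (2 * Real.pi * k - 2 * Real.pi * a) - l ^ 2 * S =
        4 * Real.pi ^ 2 * ((k : ℝ) - a) ^ 2 / S := by
      rw [hl]
      field_simp
      ring
    -- The bound a ≤ 1/2 makes 0 a nearest integer to a.
    have hk2 : a ^ 2 ≤ ((k : ℝ) - a) ^ 2 := by
      rcases le_or_gt k 0 with hk0 | hk0
      · have : (k : ℝ) ≤ 0 := by exact_mod_cast hk0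
        nlinarith [ha.1]
      · have : (1 : ℝ) ≤ k := by exact_mod_cast hk0
        nlinarith [ha.1, ha.2]
    rw [e1] at hmono
    have e2 : 4 * a ^ 2 * (Real.pi ^ 2 / S) ≤ 4 * Real.pi ^ 2 * ((k : ℝ) - a) ^ 2 / S := by
      rw [← mul_div_assoc]
      gcongr ?_ / S
      nlinarith [sq_nonneg Real.pi]
    have e3 := mul_le_mul_of_nonneg_left h1 (show 0 ≤ 4 * a ^ 2 by positivity)
    simp only [integral_sigma, smul_eq_mul]
    rw [mul_left_comm, mul_left_comm (1 - 4 * a ^ 2), ← mul_add]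
    refine mul_le_mul_of_nonneg_left ?_ (inv_nonneg.2 hpi.le)
    have hux : ∫ x in (0)..(2 * Real.pi), ‖ψ x‖ ^ 2 = ∫ x in (0)..(2 * Real.pi), u x ^ 2 := rfl
    rw [hux]
    linarith

end MagneticLowerBound

/-! ### From weak eigenfunctions to positive classical solutions. -/

section Regularity

variable {u w : ℝ → ℝ} {e : ℝ}

/-- The real weak form of the eigenvalue equation, over Lebesgue measure, so that real test
functions can be used. -/
theorem IsApply.weak_real (hu : LocAC u) (hup : Function.Periodic u (2 * Real.pi))
    (hud : MemLp (deriv u) 2 sigma) (hw : Continuous w)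
    (h : IsApply 0 w (fun x => (u x : ℂ)) (fun x => (e : ℂ) * (u x : ℂ)))
    {χ : ℝ → ℝ} (hχ : LocAC χ) (hχp : Function.Periodic χ (2 * Real.pi))
    (hχd : MemLp (deriv χ) 2 sigma) :
    ∫ x in (0)..(2 * Real.pi), (deriv u x * deriv χ x + (w x - e) * u x * χ x) = 0 := by
  obtain ⟨h1, h2⟩ := MemH1.of_real hχp hχ hχd
  obtain ⟨-, h3⟩ := MemH1.of_real hup hu hud
  have huc := hu.continuous
  have hχc := hχ.continuous
  have hdom : InFormDomain w (fun x => (χ x : ℂ)) :=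
    ⟨h1, integrable_sigma_of_continuous (hw.mul (h1.continuous.norm.pow 2))⟩
  have hweak := h.2.2 _ hdom
  have e1 : ∫ y, magDeriv 0 (fun x => (u x : ℂ)) y * conj (magDeriv 0 (fun x => (χ x : ℂ)) y) ∂sigma
      = ((∫ y, deriv u y * deriv χ y ∂sigma : ℝ) : ℂ) := by
    rw [← integral_complex_ofReal]
    refine integral_congr_ae ?_
    filter_upwards [h2, h3] with x hx hy
    simp only [magDeriv, hx, hy, Complex.ofReal_zero, mul_zero, zero_mul, sub_zero,
      Complex.conj_ofReal]
    push_cast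
    rfl
  have e2 : ∫ y, (w y : ℂ) * ((u y : ℂ) * conj (χ y : ℂ)) ∂sigma =
      ((∫ y, w y * (u y * χ y) ∂sigma : ℝ) : ℂ) := by
    rw [← integral_complex_ofReal]
    refine integral_congr_ae (Eventually.of_forall fun x => ?_)
    simp
  have e3 : ∫ y, ((e : ℂ) * (u y : ℂ)) * conj (χ y : ℂ) ∂sigma =
      ((∫ y, e * u y * χ y ∂sigma : ℝ) : ℂ) := by
    rw [← integral_complex_ofReal]
    refine integral_congr_ae (Eventually.of_forall fun x => ?_)
    simp
  rw [magForm, e1, e2, e3] at hweak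
  norm_cast at hweak
  have i1 : Integrable (fun y => deriv u y * deriv χ y) sigma := hud.integrable_mul hχd
  have i2 : Integrable (fun y => w y * (u y * χ y)) sigma :=
    integrable_sigma_of_continuous (by fun_prop)
  have i3 : Integrable (fun y => e * u y * χ y) sigma :=
    integrable_sigma_of_continuous (by fun_prop)
  have i4 : Integrable (fun y => w y * (u y * χ y) - e * u y * χ y) sigma := i2.sub i3
  have key : ∫ x, (deriv u x * deriv χ x + (w x - e) * u x * χ x) ∂sigma = 0 := by
    have : ∀ x, deriv u x * deriv χ x + (w x - e) * u x * χ x =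
        deriv u x * deriv χ x + (w x * (u x * χ x) - e * u x * χ x) := fun x => by ring
    simp only [this]
    rw [integral_add i1 i4, integral_sub i2 i3]
    linarith
  rw [integral_sigma, smul_eq_mul] at key
  exact (mul_eq_zero.1 key).resolve_left (inv_ne_zero Real.two_pi_pos.ne')

/-- Real eigenfunctions for a continuous potential are classical solutions. -/
theorem IsApply.regularity (hu : LocAC u) (hup : Function.Periodic u (2 * Real.pi))
    (hud : MemLp (deriv u) 2 sigma) (hw : Continuous w) (hwp : Function.Periodic w (2 * Real.pi))
    (h : IsApply 0 w (fun x => (u x : ℂ)) (fun x => (e : ℂ) * (u x : ℂ))) :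
    ∃ u₁ : ℝ → ℝ, Function.Periodic u₁ (2 * Real.pi) ∧ (∀ x, HasDerivAt u (u₁ x) x) ∧
      ∀ x, HasDerivAt u₁ ((w x - e) * u x) x := by
  have hpi := Real.two_pi_pos
  have huc := hu.continuous
  set f : ℝ → ℝ := fun x => (w x - e) * u x with hf
  have hfc : Continuous f := (hw.sub continuous_const).mul huc
  have hfp : Function.Periodic f (2 * Real.pi) := fun x => by simp only [hf, hup x, hwp x]
  -- Testing with the constant 1 gives the solvability condition that makes the primitive of `f`
  -- periodic.
  have hf0 : ∫ x in (0)..(2 * Real.pi), f x = 0 := by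
    have := h.weak_real hu hup hud hw (χ := fun _ => 1) (LocAC.const 1) (fun _ => rfl) (by simp)
    simpa using this
  set F : ℝ → ℝ := fun x => ∫ t in (0)..x, f t with hF
  have hFd : ∀ x, HasDerivAt F (f x) x := fun x => (hfc.integral_hasStrictDerivAt 0 x).hasDerivAt
  have hFp : Function.Periodic F (2 * Real.pi) :=
    periodic_integral_of_eq_zero hfp (fun a b => hfc.intervalIntegrable a b) hf0
  have hFc : Continuous F := continuous_iff_continuousAt.2 fun x => (hFd x).continuousAt
  have hFac : LocAC F := locAC_integral_real (fun a b => hfc.intervalIntegrable a b) 0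
  set m : ℝ := -((2 * Real.pi)⁻¹ * ∫ x in (0)..(2 * Real.pi), F x) with hm
  have hFm0 : ∫ x in (0)..(2 * Real.pi), (F x + m) = 0 := by
    rw [intervalIntegral.integral_add (hFc.intervalIntegrable _ _) intervalIntegrable_const,
      intervalIntegral.integral_const, smul_eq_mul, sub_zero, hm]
    field_simp
    ring
  have hFmc : Continuous fun x => F x + m := hFc.add continuous_const
  set K : ℝ → ℝ := fun x => ∫ t in (0)..x, (F t + m) with hK
  have hKd : ∀ x, HasDerivAt K (F x + m) x := fun x =>
    (hFmc.integral_hasStrictDerivAt 0 x).hasDerivAt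
  have hKp : Function.Periodic K (2 * Real.pi) :=
    periodic_integral_of_eq_zero (fun x => by simp only [hFp x])
      (fun a b => hFmc.intervalIntegrable a b) hFm0
  have hKac : LocAC K := locAC_integral_real (fun a b => hFmc.intervalIntegrable a b) 0
  -- `K` is a periodic solution of K'' = f; `m` was chosen to make it periodic. Testing the weak
  -- equation with u - K itself gives ∫χ'² = 0, so u and K differ by a constant.
  set χ : ℝ → ℝ := fun x => u x - K x with hχ
  have hχac : LocAC χ := hu.sub hKac
  have hχp : Function.Periodic χ (2 * Real.pi) := hup.sub hKp
  have hχd : ∀ᵐ x : ℝ, HasDerivAt χ (deriv u x - (F x + m)) x := by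
    filter_upwards [hu.ae_differentiableAt] with x hx using hx.hasDerivAt.fun_sub (hKd x)
  have hχL : MemLp (deriv χ) 2 sigma := by
    refine (hud.sub (memLp_sigma_of_continuous hFmc 2)).ae_eq (ae_sigma_of_ae ?_)
    filter_upwards [hχd] with x hx using hx.deriv.symm
  have hweak := h.weak_real hu hup hud hw hχac hχp hχL
  have hper0 : ∀ {g : ℝ → ℝ}, Function.Periodic g (2 * Real.pi) → g (2 * Real.pi) = g 0 :=
    fun hg => by simpa using hg 0
  have hparts := (hFac 0 (2 * Real.pi)).integral_deriv_mul_eq_sub (hχac 0 (2 * Real.pi))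
  rw [hper0 hFp, hper0 hχp, sub_self] at hparts
  have hχint := (hχac 0 (2 * Real.pi)).integral_deriv_eq_sub
  rw [hper0 hχp, sub_self] at hχint
  have hci := (hχac 0 (2 * Real.pi)).intervalIntegrable_deriv
  have j1 : IntervalIntegrable (fun x => deriv u x * deriv χ x + (w x - e) * u x * χ x) volume
      0 (2 * Real.pi) :=
    (integrable_sigma_iff.1 (hud.integrable_mul hχL)).add
      ((hfc.mul hχac.continuous).intervalIntegrable _ _)
  have j2 : IntervalIntegrable (fun x => deriv F x * χ x + F x * deriv χ x) volume
      0 (2 * Real.pi) :=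
    ((hFac 0 (2 * Real.pi)).intervalIntegrable_deriv.mul_continuousOn
      hχac.continuous.continuousOn).add (hci.continuousOn_mul hFc.continuousOn)
  have hsq : ∫ x in (0)..(2 * Real.pi), deriv χ x ^ 2 = 0 := by
    have e1 : ∫ x in (0)..(2 * Real.pi), deriv χ x ^ 2 = ∫ x in (0)..(2 * Real.pi),
        ((deriv u x * deriv χ x + (w x - e) * u x * χ x) -
          (deriv F x * χ x + F x * deriv χ x) - m * deriv χ x) := by
      refine intervalIntegral.integral_congr_ae ?_
      filter_upwards [hχd] with x hx _
      rw [hx.deriv, (hFd x).deriv]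
      simp only [hf]
      ring
    rw [e1, intervalIntegral.integral_sub (j1.sub j2) (hci.const_mul m),
      intervalIntegral.integral_sub j1 j2, hweak, hparts, intervalIntegral.integral_const_mul,
      hχint]
    ring
  have hzero : ∀ᵐ x : ℝ, x ∈ Ioc 0 (2 * Real.pi) → deriv χ x = 0 := by
    have hint : IntegrableOn (fun x => deriv χ x ^ 2) (Ioc 0 (2 * Real.pi)) volume := by
      have : Integrable (fun x => deriv χ x ^ 2) sigma := by
        simpa using hχL.integrable_norm_pow (p := 2) (by norm_num)
      exact (integrable_sigma_iff.1 this).1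
    rw [intervalIntegral.integral_of_le hpi.le,
      integral_eq_zero_iff_of_nonneg (fun _ => sq_nonneg _) hint] at hsq
    filter_upwards [(ae_restrict_iff' measurableSet_Ioc).1 hsq] with x hx hmem
    exact pow_eq_zero_iff (two_ne_zero) |>.1 (hx hmem)
  have hconst : ∀ x, χ x = χ 0 := by
    have hIcc : ∀ x ∈ Icc 0 (2 * Real.pi), χ x = χ 0 := by
      intro x hx
      have h1 := (hχac 0 x).integral_deriv_eq_sub
      have h2 : ∫ t in (0)..x, deriv χ t = 0 := by
        refine (intervalIntegral.integral_congr_ae (g := fun _ => (0 : ℝ)) ?_).trans (by simp)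
        filter_upwards [hzero] with t ht hmem
        rw [uIoc_of_le hx.1] at hmem
        exact ht ⟨hmem.1, hmem.2.trans hx.2⟩
      linarith
    intro x
    obtain ⟨y, hy, hxy⟩ := hχp.exists_mem_Ico₀ hpi x
    rw [hxy]
    exact hIcc y (Ico_subset_Icc_self hy)
  have hueq : u = fun x => χ 0 + K x := by
    funext x
    have := hconst x
    simp only [hχ] at this ⊢
    linarith
  refine ⟨fun x => F x + m, fun x => by simp only [hFp x], fun x => ?_, fun x => ?_⟩
  · have := (hKd x).const_add (χ 0)
    rwa [← hueq] at this
  · exact (hFd x).add_const m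

/-- Nonnegative periodic solutions of a linear second order equation are positive or vanish. -/
theorem pos_of_nonneg_of_ode {u u₁ W : ℝ → ℝ} (hu0 : ∀ x, 0 ≤ u x) {C : ℝ} (hC : ∀ x, |W x| ≤ C)
    (h1 : ∀ x, HasDerivAt u (u₁ x) x) (h2 : ∀ x, HasDerivAt u₁ (W x * u x) x)
    (hne : ∃ x, u x ≠ 0) (x : ℝ) : 0 < u x := by
  refine lt_of_le_of_ne (hu0 x) fun h0 => ?_
  have hmin : IsLocalMin u x := Eventually.of_forall fun y => by rw [← h0]; exact hu0 y
  have hd0 : u₁ x = 0 := hmin.hasDerivAt_eq_zero (h1 x)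
  have hC0 : 0 ≤ C := (abs_nonneg _).trans (hC x)
  -- At a zero, which is a minimum, both u and u' vanish, so uniqueness for the first-order system
  -- forces u ≡ 0.
  have hzero := ODE_solution_unique_univ (v := fun t (z : ℝ × ℝ) => (z.2, W t * z.1))
    (K := (C + 1).toNNReal) (s := fun _ => univ) (f := fun t => (u t, u₁ t))
    (g := fun _ => (0, 0)) (t₀ := x)
    (by
      intro t
      refine LipschitzOnWith.of_dist_le_mul fun z _ z' _ => ?_
      simp only [Real.coe_toNNReal (C + 1) (by linarith), Prod.dist_eq, Real.dist_eq, ← mul_sub,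
        abs_mul]
      have hm1 := le_max_left |z.1 - z'.1| |z.2 - z'.2|
      have hm2 := le_max_right |z.1 - z'.1| |z.2 - z'.2|
      have hm0 := (abs_nonneg _).trans hm1
      refine max_le (by nlinarith) ?_
      have := mul_le_mul (hC t) hm1 (abs_nonneg _) hC0
      nlinarith)
    (fun t => ⟨(h1 t).prodMk (h2 t), mem_univ _⟩)
    (fun t => ⟨(hasDerivAt_const t ((0 : ℝ), (0 : ℝ))).congr_deriv (by ext <;> simp), mem_univ _⟩)
    (by rw [← h0, hd0])
  obtain ⟨y, hy⟩ := hne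
  exact hy (congrArg Prod.fst (congrFun hzero y))

end Regularity

/-! ### Poincaré's inequality and the carré du champ method. -/

section Rigidity

/-- The Poincaré inequality for periodic functions of zero average. -/
theorem poincare_periodic {f f' : ℝ → ℝ} (hf : ∀ x, HasDerivAt f (f' x) x) (hf' : Continuous f')
    (hp : Function.Periodic f (2 * Real.pi)) (h0 : ∫ x in (0)..(2 * Real.pi), f x = 0) :
    ∫ x in (0)..(2 * Real.pi), f x ^ 2 ≤ ∫ x in (0)..(2 * Real.pi), f' x ^ 2 := by
  have hpi := Real.pi_pos
  have hd : deriv f = f' := funext fun x => (hf x).deriv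
  have hfc : Continuous f := continuous_iff_continuousAt.2 fun x => (hf x).continuousAt
  have hp' : Function.Periodic f' (2 * Real.pi) := hd ▸ periodic_deriv hp
  -- f(x + π) - f(x) changes sign under x ↦ x + π. Subtracting the common value c gives zeros at x₀,
  -- x₀ + π and x₀ + 2π, hence the Dirichlet constant 1 on each half period; as `f` has mean zero,
  -- subtracting c only increases ∫f².
  obtain ⟨x₀, hx₀⟩ : ∃ x₀, f (x₀ + Real.pi) = f x₀ := by
    have hc : Continuous fun x => f (x + Real.pi) - f x := by fun_prop
    have e : f (Real.pi + Real.pi) - f Real.pi = -(f (0 + Real.pi) - f 0) := by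
      have := hp 0
      rw [← two_mul, zero_add]
      rw [zero_add] at this
      rw [this]
      ring
    have := intermediate_value_uIcc (a := 0) (b := Real.pi) hc.continuousOn
      (show (0 : ℝ) ∈ uIcc _ _ by
        simp only [e]
        rw [mem_uIcc]
        rcases le_total 0 (f (0 + Real.pi) - f 0) with h | h
        · exact Or.inr ⟨by linarith, h⟩
        · exact Or.inl ⟨h, by linarith⟩)
    obtain ⟨x₀, -, hx₀⟩ := this
    exact ⟨x₀, sub_eq_zero.1 hx₀⟩
  set c := f x₀ with hc
  set g : ℝ → ℝ := fun x => f x - c with hg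
  have hgd : deriv g = f' := funext fun x => ((hf x).sub_const c).deriv
  have hgac : LocAC g := locAC_of_contDiff (by
    rw [contDiff_one_iff_deriv, hgd]
    exact ⟨fun x => ((hf x).sub_const c).differentiableAt, hf'⟩)
  have hi : ∀ a b, IntervalIntegrable (fun x => deriv g x ^ 2) volume a b := by
    rw [hgd]
    exact fun a b => (hf'.pow 2).intervalIntegrable a b
  have hgc : Continuous g := hgac.continuous
  have hgi : ∀ a b, IntervalIntegrable (fun x => g x ^ 2) volume a b :=
    fun a b => (hgc.pow 2).intervalIntegrable a b
  have e2 : x₀ + Real.pi + Real.pi = x₀ + 2 * Real.pi := by ring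
  have h1 := wirtinger_dirichlet hgac (b := x₀) hpi (by simp [hg, hc])
    (by simp [hg, hx₀]) (hi _ _)
  have h2 := wirtinger_dirichlet hgac (b := x₀ + Real.pi) hpi (by simp [hg, hx₀])
    (by rw [e2]; simp [hg, hp x₀, hc]) (hi _ _)
  have h3 := add_le_add h1 h2
  rw [div_self hpi.ne', one_pow, one_mul, one_mul,
    intervalIntegral.integral_add_adjacent_intervals (hgi _ _) (hgi _ _),
    intervalIntegral.integral_add_adjacent_intervals (hi _ _) (hi _ _), e2, hgd,
    Function.Periodic.intervalIntegral_add_eq (f := fun x => g x ^ 2)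
      (fun x => by simp only [hg, hp x]) x₀ 0,
    Function.Periodic.intervalIntegral_add_eq (f := fun x => f' x ^ 2)
      (fun x => by simp only [hp' x]) x₀ 0, zero_add] at h3
  refine le_trans ?_ h3
  have e3 : ∀ x, g x ^ 2 = f x ^ 2 + (-(2 * c) * f x + c ^ 2) := fun x => by
    simp only [hg]
    ring
  simp only [e3]
  rw [intervalIntegral.integral_add (f := fun x => f x ^ 2) ((hfc.pow 2).intervalIntegrable _ _)
    (((hfc.intervalIntegrable _ _).const_mul _).add intervalIntegrable_const),
    intervalIntegral.integral_add ((hfc.intervalIntegrable _ _).const_mul _)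
      intervalIntegrable_const, intervalIntegral.integral_const_mul, h0,
    intervalIntegral.integral_const, smul_eq_mul]
  have : 0 ≤ (2 * Real.pi - 0) * c ^ 2 := by
    have := sq_nonneg c
    nlinarith
  linarith

/-- The carré du champ estimate for positive solutions of
`-u'' + ν u (u² + δ)^(-s/2) = λ u`, in terms of `g = ν (u² + δ)^(-s/2)`. -/
theorem carre_du_champ {u u₁ g : ℝ → ℝ} {l s δ : ℝ} (hl : 0 ≤ l) (hs0 : 0 ≤ s) (hs1 : s ≤ 1)
    (hδ : 0 < δ) (hpos : ∀ x, 0 < u x) (h1 : ∀ x, HasDerivAt u (u₁ x) x)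
    (h2 : ∀ x, HasDerivAt u₁ ((g x - l) * u x) x)
    (h3 : ∀ x, HasDerivAt g (-(s * g x * u x * u₁ x / (u x ^ 2 + δ))) x)
    (hup : Function.Periodic u (2 * Real.pi)) (hu₁p : Function.Periodic u₁ (2 * Real.pi))
    (hgp : Function.Periodic g (2 * Real.pi)) :
    ∫ x in (0)..(2 * Real.pi), ((g x - l) * u x) ^ 2 ≤
      l * s * ∫ x in (0)..(2 * Real.pi), u₁ x ^ 2 := by
  have hpi := Real.two_pi_pos
  have cu : Continuous u := continuous_iff_continuousAt.2 fun x => (h1 x).continuousAt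
  have cu₁ : Continuous u₁ := continuous_iff_continuousAt.2 fun x => (h2 x).continuousAt
  have cg : Continuous g := continuous_iff_continuousAt.2 fun x => (h3 x).continuousAt
  have hr : ∀ x, 0 < u x ^ 2 + δ := fun x => by positivity
  have cr : Continuous fun x => (u x ^ 2 + δ)⁻¹ :=
    ((cu.pow 2).add continuous_const).inv₀ fun x => (hr x).ne'
  have ci : Continuous fun x => (u x)⁻¹ := cu.inv₀ fun x => (hpos x).ne'
  -- The coefficient is chosen so that the terms in g·u'² cancel in the derivative of Φ below. What
  -- remains is u''², a quartic term in u', and a multiple of u'² by l.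
  set k : ℝ → ℝ := fun x => (u x)⁻¹ - s * u x / (u x ^ 2 + δ) with hk
  set k' : ℝ → ℝ := fun x => -((u x)⁻¹) ^ 2 - s * (δ - u x ^ 2) * ((u x ^ 2 + δ)⁻¹) ^ 2 with hk'
  have hkd : ∀ x, HasDerivAt k (k' x * u₁ x) x := by
    intro x
    have hx := (hpos x).ne'
    have hrx := (hr x).ne'
    have := ((h1 x).fun_inv hx).fun_sub
      (((h1 x).const_mul s).fun_div (((h1 x).fun_pow 2).add_const δ) hrx)
    refine this.congr_deriv ?_
    simp only [hk']
    field_simp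
    push_cast
    ring
  set Φ : ℝ → ℝ := fun x => g x * u x * u₁ x - k x * u₁ x ^ 3 / 3 - l * (u x * u₁ x) with hΦ
  set Φ' : ℝ → ℝ := fun x => ((g x - l) * u x) ^ 2 - k' x * u₁ x ^ 4 / 3 -
    l * (s * u x ^ 2 * (u x ^ 2 + δ)⁻¹) * u₁ x ^ 2 with hΦ'
  have hΦd : ∀ x, HasDerivAt Φ (Φ' x) x := by
    intro x
    have hx := (hpos x).ne'
    have hrx := (hr x).ne'
    have := ((((h3 x).fun_mul (h1 x)).fun_mul (h2 x)).fun_sub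
      (((hkd x).fun_mul ((h2 x).fun_pow 3)).div_const 3)).fun_sub
      (((h1 x).fun_mul (h2 x)).const_mul l)
    refine this.congr_deriv ?_
    simp only [hΦ', hk]
    field_simp
    push_cast
    ring
  have cΦ' : Continuous Φ' := by
    simp only [hΦ', hk']
    fun_prop
  have hint := intervalIntegral.integral_eq_sub_of_hasDerivAt (a := 0) (b := 2 * Real.pi)
    (fun x _ => hΦd x) (cΦ'.intervalIntegrable _ _)
  have hΦp : Φ (2 * Real.pi) = Φ 0 := by
    have e1 : u (2 * Real.pi) = u 0 := by simpa using hup 0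
    have e2 : u₁ (2 * Real.pi) = u₁ 0 := by simpa using hu₁p 0
    have e3 : g (2 * Real.pi) = g 0 := by simpa using hgp 0
    simp only [hΦ, hk, e1, e2, e3]
  rw [hΦp, sub_self] at hint
  have c2 : Continuous fun x => ((g x - l) * u x) ^ 2 := by fun_prop
  have hle : ∫ x in (0)..(2 * Real.pi), (((g x - l) * u x) ^ 2 - l * s * u₁ x ^ 2) ≤
      ∫ x in (0)..(2 * Real.pi), Φ' x := by
    refine intervalIntegral.integral_mono_on hpi.le ?_ (cΦ'.intervalIntegrable _ _) fun x _ => ?_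
    · exact (c2.sub (by fun_prop)).intervalIntegrable _ _
    · have hk0 : k' x ≤ 0 := by
        have hx := hpos x
        have hrx := hr x
        have e1 : (u x ^ 2 - δ) * ((u x ^ 2 + δ)⁻¹) ^ 2 ≤ ((u x)⁻¹) ^ 2 := by
          rw [← sub_nonneg]
          have : ((u x)⁻¹) ^ 2 - (u x ^ 2 - δ) * ((u x ^ 2 + δ)⁻¹) ^ 2 =
              (3 * u x ^ 2 * δ + δ ^ 2) * (((u x)⁻¹) ^ 2 * ((u x ^ 2 + δ)⁻¹) ^ 2) := by
            field_simp
            ring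
          rw [this]
          positivity
        have e2 : 0 ≤ ((u x)⁻¹) ^ 2 := by positivity
        have e3 : s * ((u x ^ 2 - δ) * ((u x ^ 2 + δ)⁻¹) ^ 2) ≤ ((u x)⁻¹) ^ 2 :=
          (mul_le_mul_of_nonneg_left e1 hs0).trans (mul_le_of_le_one_left e2 hs1)
        simp only [hk']
        linarith
      have h4 : 0 ≤ u₁ x ^ 4 := by positivity
      have h5 : u x ^ 2 * (u x ^ 2 + δ)⁻¹ ≤ 1 := by
        rw [← div_eq_mul_inv, div_le_one (hr x)]
        linarith
      have h6 : l * (s * u x ^ 2 * (u x ^ 2 + δ)⁻¹) * u₁ x ^ 2 ≤ l * s * u₁ x ^ 2 := by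
        have := mul_le_mul_of_nonneg_left h5 (show 0 ≤ l * s * u₁ x ^ 2 by positivity)
        linarith
      have h7 : k' x * u₁ x ^ 4 ≤ 0 := mul_nonpos_of_nonpos_of_nonneg hk0 h4
      simp only [hΦ']
      linarith
  rw [hint, intervalIntegral.integral_sub (c2.intervalIntegrable _ _)
    ((by fun_prop : Continuous fun x => l * s * u₁ x ^ 2).intervalIntegrable _ _),
    intervalIntegral.integral_const_mul] at hle
  linarith

/-- Rigidity: the solutions of the carré du champ estimate are constant. -/
theorem eq_const_of_carre_du_champ {u u₁ g : ℝ → ℝ} {l s δ : ℝ} (hl : 0 ≤ l) (hs0 : 0 ≤ s)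
    (hs1 : s ≤ 1) (hls : l * s < 1) (hδ : 0 < δ) (hpos : ∀ x, 0 < u x)
    (h1 : ∀ x, HasDerivAt u (u₁ x) x) (h2 : ∀ x, HasDerivAt u₁ ((g x - l) * u x) x)
    (h3 : ∀ x, HasDerivAt g (-(s * g x * u x * u₁ x / (u x ^ 2 + δ))) x)
    (hup : Function.Periodic u (2 * Real.pi)) (hu₁p : Function.Periodic u₁ (2 * Real.pi))
    (hgp : Function.Periodic g (2 * Real.pi)) (x : ℝ) : u x = u 0 := by
  have hpi := Real.two_pi_pos
  have cu : Continuous u := continuous_iff_continuousAt.2 fun x => (h1 x).continuousAt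
  have cu₁ : Continuous u₁ := continuous_iff_continuousAt.2 fun x => (h2 x).continuousAt
  have cg : Continuous g := continuous_iff_continuousAt.2 fun x => (h3 x).continuousAt
  have hbe := carre_du_champ hl hs0 hs1 hδ hpos h1 h2 h3 hup hu₁p hgp
  have hint0 : ∫ x in (0)..(2 * Real.pi), u₁ x = 0 := by
    rw [intervalIntegral.integral_eq_sub_of_hasDerivAt (fun x _ => h1 x)
      (cu₁.intervalIntegrable _ _)]
    have : u (2 * Real.pi) = u 0 := by simpa using hup 0
    rw [this, sub_self]
  -- Poincaré applied to u' gives ∫u'² ≤ ∫u''² ≤ ls∫u'², so ls < 1 leaves only u' = 0.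
  have hpo := poincare_periodic h2 (by fun_prop) hu₁p hint0
  have hz : ∫ x in (0)..(2 * Real.pi), u₁ x ^ 2 ≤ 0 := by
    by_contra! hlt
    nlinarith
  have hu₁0 : ∀ x, u₁ x = 0 := by
    by_contra! hne
    obtain ⟨x, hx⟩ := hne
    have hsq := integral_pos_of_continuous (f := fun x => u₁ x ^ 2) (cu₁.pow 2) (fun _ => sq_nonneg _)
      (fun x => by simp only [hu₁p x]) ⟨x, pow_ne_zero 2 hx⟩
    rw [integral_sigma, smul_eq_mul] at hsq
    have := inv_pos.2 hpi
    nlinarith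
  refine is_const_of_deriv_eq_zero (fun x => (h1 x).differentiableAt) (fun x => ?_) x 0
  rw [(h1 x).deriv, hu₁0 x]

end Rigidity

/-! ### The sharp interpolation inequality by regularisation and rigidity. -/

section Beckner

variable {ψ χ : ℝ → ℂ}

/-- The tangent inequality for the concave functional `w ↦ (∫ w ^ θ) ^ (1 / θ)`. -/
theorem rpow_integral_rpow_le {w r : ℝ → ℝ} (hw : Continuous w) (hr : Continuous r)
    (hw0 : ∀ x, 0 < w x) (hr0 : ∀ x, 0 < r x) {θ : ℝ} (h0 : 0 < θ) (h1 : θ < 1) :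
    (∫ y, w y ^ θ ∂sigma) ^ θ⁻¹ ≤
      (∫ y, r y ^ θ ∂sigma) ^ (θ⁻¹ - 1) * ∫ y, r y ^ (θ - 1) * w y ∂sigma := by
  have h1' : 0 < 1 - θ := by linarith
  have hconj : (θ⁻¹).HolderConjugate (1 - θ)⁻¹ := by
    rw [Real.holderConjugate_iff]
    refine ⟨(one_lt_inv₀ h0).2 h1, ?_⟩
    rw [inv_inv, inv_inv]
    ring
  have hrc : ∀ t : ℝ, Continuous fun x => r x ^ t := fun t =>
    hr.rpow_const fun x => Or.inl (hr0 x).ne'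
  have hwc : Continuous fun x => (r x ^ (θ - 1) * w x) ^ θ :=
    ((hrc _).mul hw).rpow_const fun x => Or.inr h0.le
  -- Hölder for w^θ = (r^{θ-1}w)^θ · r^{θ(1-θ)}, with exponents 1/θ and 1/(1 - θ); equality holds at
  -- w = r.
  have hold := integral_mul_le_Lp_mul_Lq_of_nonneg (μ := sigma) hconj
    (f := fun x => (r x ^ (θ - 1) * w x) ^ θ) (g := fun x => r x ^ (θ * (1 - θ)))
    (Eventually.of_forall fun x => by have := hr0 x; have := hw0 x; positivity)
    (Eventually.of_forall fun x => by have := hr0 x; positivity)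
    (memLp_sigma_of_continuous hwc _) (memLp_sigma_of_continuous (hrc _) _)
  have e1 : ∀ x, (r x ^ (θ - 1) * w x) ^ θ * r x ^ (θ * (1 - θ)) = w x ^ θ := by
    intro x
    rw [Real.mul_rpow (Real.rpow_nonneg (hr0 x).le _) (hw0 x).le, ← Real.rpow_mul (hr0 x).le,
      mul_right_comm, ← Real.rpow_add (hr0 x), show (θ - 1) * θ + θ * (1 - θ) = 0 by ring,
      Real.rpow_zero, one_mul]
  have e2 : ∀ x, ((r x ^ (θ - 1) * w x) ^ θ) ^ θ⁻¹ = r x ^ (θ - 1) * w x := fun x =>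
    Real.rpow_rpow_inv (by have := hr0 x; have := hw0 x; positivity) h0.ne'
  have e3 : ∀ x, (r x ^ (θ * (1 - θ))) ^ (1 - θ)⁻¹ = r x ^ θ := by
    intro x
    rw [← Real.rpow_mul (hr0 x).le, mul_assoc, mul_inv_cancel₀ h1'.ne', mul_one]
  simp only [e1, e2, e3, one_div, inv_inv] at hold
  have hA : 0 ≤ ∫ y, r y ^ (θ - 1) * w y ∂sigma :=
    integral_nonneg fun x => by have := hr0 x; have := hw0 x; positivity
  have hX : 0 ≤ ∫ y, r y ^ θ ∂sigma := integral_nonneg fun x => by have := hr0 x; positivity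
  have hY : 0 ≤ ∫ y, w y ^ θ ∂sigma := integral_nonneg fun x => by have := hw0 x; positivity
  have := Real.rpow_le_rpow hY hold (inv_nonneg.2 h0.le)
  rw [Real.mul_rpow (by positivity) (by positivity), Real.rpow_rpow_inv hA h0.ne',
    ← Real.rpow_mul hX, show (1 - θ) * θ⁻¹ = θ⁻¹ - 1 by field_simp] at this
  linarith

theorem magDeriv_zero (ψ : ℝ → ℂ) : magDeriv 0 ψ = deriv ψ := by
  funext y
  simp [magDeriv]

theorem continuous_normSq_add_rpow (h : MemH1 ψ) {δ : ℝ} (hδ : 0 < δ) (t : ℝ) :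
    Continuous fun y => (‖ψ y‖ ^ 2 + δ) ^ t := by
  have hc : Continuous fun y => ‖ψ y‖ ^ 2 + δ := (h.continuous.norm.pow 2).add continuous_const
  have hpos : ∀ y, 0 < ‖ψ y‖ ^ 2 + δ := fun y => by positivity
  exact hc.rpow_const fun y => Or.inl (hpos y).ne'

theorem tendsto_integral_normSq_add_rpow {u : ℕ → ℝ → ℂ} {C δ θ : ℝ} (hδ : 0 < δ) (hθ : 0 ≤ θ)
    (hu : ∀ n, MemH1 (u n)) (hlim : ∀ x, Tendsto (fun n => u n x) atTop (𝓝 (ψ x)))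
    (hC : ∀ n x, ‖u n x‖ ≤ C) :
    Tendsto (fun n => ∫ y, (‖u n y‖ ^ 2 + δ) ^ θ ∂sigma) atTop
      (𝓝 (∫ y, (‖ψ y‖ ^ 2 + δ) ^ θ ∂sigma)) := by
  refine tendsto_integral_of_dominated_convergence (fun _ => (C ^ 2 + δ) ^ θ) ?_
    (integrable_const _) ?_ ?_
  · exact fun n => (continuous_normSq_add_rpow (hu n) hδ θ).aestronglyMeasurable
  · refine fun n => Eventually.of_forall fun x => ?_
    rw [Real.norm_of_nonneg (by positivity)]
    refine Real.rpow_le_rpow (by positivity) ?_ hθ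
    have := pow_le_pow_left₀ (norm_nonneg _) (hC n x) 2
    linarith
  · exact Eventually.of_forall fun x =>
      (((hlim x).norm.pow 2).add_const δ).rpow_const (Or.inr hθ)

/-- The minimiser of the regularised functional may be chosen nonnegative. -/
theorem exists_nonneg_minimizer {μ δ θ : ℝ} (hμ : 0 < μ) (hδ : 0 < δ) (hθ : 0 < θ) :
    ∃ u : ℝ → ℝ, LocAC u ∧ Function.Periodic u (2 * Real.pi) ∧ MemLp (deriv u) 2 sigma ∧
      (∀ x, 0 ≤ u x) ∧ ∫ y, u y ^ 2 ∂sigma = 1 ∧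
      ∀ χ, MemH1 χ → ∫ y, ‖χ y‖ ^ 2 ∂sigma = 1 →
        ∫ y, deriv u y ^ 2 ∂sigma + μ * (∫ y, (u y ^ 2 + δ) ^ θ ∂sigma) ^ θ⁻¹ ≤
          ∫ y, ‖deriv χ y‖ ^ 2 ∂sigma + μ * (∫ y, (‖χ y‖ ^ 2 + δ) ^ θ ∂sigma) ^ θ⁻¹ := by
  have hX : ∀ χ : ℝ → ℂ, 0 ≤ ∫ y, (‖χ y‖ ^ 2 + δ) ^ θ ∂sigma := fun χ =>
    integral_nonneg fun _ => by positivity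
  obtain ⟨ψ, hψ, hn, -, hmin⟩ := exists_minimizer 0
    (fun ψ => ENNReal.ofReal (μ * (∫ y, (‖ψ y‖ ^ 2 + δ) ^ θ ∂sigma) ^ θ⁻¹))
    (by
      intro u ψ C hu hψ hlim hC
      have ht := tendsto_integral_normSq_add_rpow hδ hθ.le hu hlim hC
      exact (ENNReal.tendsto_ofReal ((ht.rpow_const
        (Or.inr (inv_nonneg.2 hθ.le))).const_mul μ)).liminf_eq.ge)
    ⟨fun _ => 1, memH1_const 1, by simp, ENNReal.ofReal_ne_top⟩
  refine ⟨fun x => ‖ψ x‖, hψ.locAC.norm, fun x => by simp only [hψ.periodic x],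
    hψ.memLp_deriv_norm, fun x => norm_nonneg _, hn, fun χ hχ hχn => ?_⟩
  have h1 := hmin χ hχ hχn
  have h2 := hψ.integral_deriv_norm_sq_le 0
  have hV : ∀ χ : ℝ → ℂ, 0 ≤ μ * (∫ y, (‖χ y‖ ^ 2 + δ) ^ θ ∂sigma) ^ θ⁻¹ := fun χ =>
    mul_nonneg hμ.le (Real.rpow_nonneg (hX χ) _)
  have hD : ∀ χ : ℝ → ℂ, 0 ≤ ∫ y, ‖deriv χ y‖ ^ 2 ∂sigma := fun χ =>
    integral_nonneg fun _ => by positivity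
  rw [magDeriv_zero] at h2
  rw [magDeriv_zero, magDeriv_zero, ← ENNReal.ofReal_add (hD _) (hV _),
    ← ENNReal.ofReal_add (hD _) (hV _), ENNReal.ofReal_le_ofReal_iff
    (add_nonneg (hD _) (hV _))] at h1
  linarith

/-- The sharp interpolation inequality on the circle, with regularised norms. -/
theorem interpolation_regularized {μ δ p : ℝ} (hμ : 0 < μ) (hδ : 0 < δ)
    (hp : p ∈ Ico (1 : ℝ) 2) (hsub : μ * (1 + δ) * (2 - p) < 1) (hχ : MemH1 χ)
    (hχn : ∫ y, ‖χ y‖ ^ 2 ∂sigma = 1) :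
    μ * (1 + δ) ≤ ∫ y, ‖deriv χ y‖ ^ 2 ∂sigma +
      μ * (∫ y, (‖χ y‖ ^ 2 + δ) ^ (p / 2) ∂sigma) ^ (p / 2)⁻¹ := by
  obtain ⟨hp1, hp2⟩ := hp
  have hθ0 : 0 < p / 2 := by linarith
  have hθ1 : p / 2 < 1 := by linarith
  set θ := p / 2 with hθ
  obtain ⟨u, hu, hup, hud, hu0, hun, hmin⟩ := exists_nonneg_minimizer (θ := θ) hμ hδ hθ0
  have huc := hu.continuous
  have hrc : Continuous fun y => u y ^ 2 + δ := by fun_prop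
  have hrpos : ∀ y, 0 < u y ^ 2 + δ := fun y => by positivity
  have hrpc : ∀ t : ℝ, Continuous fun y => (u y ^ 2 + δ) ^ t := fun t =>
    hrc.rpow_const fun y => Or.inl (hrpos y).ne'
  set X := ∫ y, (u y ^ 2 + δ) ^ θ ∂sigma with hX
  have hX0 : 0 < X := integral_pos_of_continuous (hrpc θ)
    (fun y => Real.rpow_nonneg (hrpos y).le _) (fun y => by simp only [hup y])
    ⟨0, (Real.rpow_pos_of_pos (hrpos 0) _).ne'⟩
  -- The potential g = ν(u² + δ)^{θ-1} is the derivative of the regularised functional, as a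
  -- function of u², at the minimiser.
  set ν := μ * X ^ (θ⁻¹ - 1) with hν
  have hν0 : 0 < ν := mul_pos hμ (Real.rpow_pos_of_pos hX0 _)
  set g : ℝ → ℝ := fun y => ν * (u y ^ 2 + δ) ^ (θ - 1) with hg
  have hgc : Continuous g := continuous_const.mul (hrpc _)
  have hgp : Function.Periodic g (2 * Real.pi) := fun y => by simp only [hg, hup y]
  have hg0 : ∀ y, 0 < g y := fun y => mul_pos hν0 (Real.rpow_pos_of_pos (hrpos y) _)
  obtain ⟨hv, hvd⟩ := MemH1.of_real hup hu hud
  have hdom : ∀ {χ : ℝ → ℂ}, MemH1 χ → InFormDomain g χ := fun hχ =>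
    ⟨hχ, integrable_sigma_of_continuous (hgc.mul (hχ.continuous.norm.pow 2))⟩
  -- the total mass of the potential
  have hgX : ∫ y, g y * (u y ^ 2 + δ) ∂sigma = μ * X ^ θ⁻¹ := by
    have e : ∀ y, g y * (u y ^ 2 + δ) = ν * (u y ^ 2 + δ) ^ θ := by
      intro y
      simp only [hg]
      rw [mul_assoc]
      nth_rewrite 2 [← Real.rpow_one (u y ^ 2 + δ)]
      rw [← Real.rpow_add (hrpos y), sub_add_cancel]
    simp only [e]
    rw [integral_const_mul, ← hX, hν, mul_assoc]
    nth_rewrite 2 [← Real.rpow_one X]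
    rw [← Real.rpow_add hX0, sub_add_cancel]
  have hsplit : ∀ {f : ℝ → ℝ}, Continuous f → ∫ y, g y * (f y + δ) ∂sigma =
      ∫ y, g y * f y ∂sigma + δ * ∫ y, g y ∂sigma := by
    intro f hf
    have : ∀ y, g y * (f y + δ) = g y * f y + δ * g y := fun y => by ring
    have hi : Integrable (fun y => g y * f y) sigma :=
      integrable_sigma_of_continuous (hgc.mul hf)
    have hi' : Integrable (fun y => δ * g y) sigma :=
      integrable_sigma_of_continuous (continuous_const.mul hgc)
    simp only [this]
    rw [integral_add hi hi', integral_const_mul]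
  have hgu := hsplit (f := fun y => u y ^ 2) (by fun_prop)
  have hgint : 0 ≤ ∫ y, g y ∂sigma := integral_nonneg fun y => (hg0 y).le
  set l := energy 0 g (fun y => (u y : ℂ)) with hl
  have hDu : ∫ y, ‖magDeriv 0 (fun y => (u y : ℂ)) y‖ ^ 2 ∂sigma =
      ∫ y, deriv u y ^ 2 ∂sigma := by
    rw [magDeriv_zero]
    refine integral_congr_ae ?_
    filter_upwards [hvd] with y hy
    rw [hy, Complex.norm_real, Real.norm_eq_abs, sq_abs]
  have hle : l = ∫ y, deriv u y ^ 2 ∂sigma + ∫ y, g y * u y ^ 2 ∂sigma := by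
    rw [hl, energy, hDu]
    simp only [Complex.norm_real, Real.norm_eq_abs, sq_abs]
  have hun' : ∫ y, ‖(u y : ℂ)‖ ^ 2 ∂sigma = 1 := by
    simpa only [Complex.norm_real, Real.norm_eq_abs, sq_abs] using hun
  -- `u` is a ground state of the linearised problem
  have hlow : ∀ χ, InFormDomain g χ → l * ∫ y, ‖χ y‖ ^ 2 ∂sigma ≤ energy 0 g χ := by
    intro χ hχ
    refine mul_integral_le_energy (fun χ hχ h1 => ?_) hχ
    have hm := hmin χ hχ.1 h1
    have ht := rpow_integral_rpow_le (w := fun y => ‖χ y‖ ^ 2 + δ) (r := fun y => u y ^ 2 + δ)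
      ((hχ.1.continuous.norm.pow 2).add continuous_const) hrc (fun y => by positivity) hrpos
      hθ0 hθ1
    have ht' : μ * (∫ y, (‖χ y‖ ^ 2 + δ) ^ θ ∂sigma) ^ θ⁻¹ ≤
        ∫ y, g y * (‖χ y‖ ^ 2 + δ) ∂sigma := by
      refine (mul_le_mul_of_nonneg_left ht hμ.le).trans_eq ?_
      simp only [hg, mul_assoc]
      rw [integral_const_mul, hν, mul_assoc]
    rw [hsplit (f := fun y => ‖χ y‖ ^ 2) (hχ.1.continuous.norm.pow 2)] at ht'
    rw [hle, energy, magDeriv_zero]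
    linarith
  have happ := isApply_of_minimizer hgc.aestronglyMeasurable
    (Eventually.of_forall fun y => (hg0 y).le) (hdom hv) (by rw [hun', mul_one]) hlow
  obtain ⟨u₁, hu₁p, hd1, hd2⟩ := happ.regularity hu hup hud hgc hgp
  have hne : ∃ x, u x ≠ 0 := by
    by_contra! h
    simp [h] at hun
  have hl0 : 0 ≤ l := by
    rw [hle]
    exact add_nonneg (integral_nonneg fun _ => sq_nonneg _)
      (integral_nonneg fun y => mul_nonneg (hg0 y).le (sq_nonneg _))
  -- Comparison with the constant 1 gives l ≤ μ(1 + δ), which the subcriticality assumption turns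
  -- into l(2 - p) < 1.
  have hone := hmin _ (memH1_const 1) (by simp)
  have hN1 : (((1 : ℝ) + δ) ^ θ) ^ θ⁻¹ = 1 + δ := Real.rpow_rpow_inv (by positivity) hθ0.ne'
  simp only [deriv_const, norm_zero, ne_eq, OfNat.ofNat_ne_zero, not_false_eq_true, zero_pow,
    integral_zero, norm_one, one_pow, integral_const, probReal_univ, one_smul, zero_add,
    hN1] at hone
  have hl1 : l ≤ μ * (1 + δ) := by
    rw [hle]
    have := mul_nonneg hδ.le hgint
    linarith
  have hpos : ∀ x, 0 < u x := by
    -- The exponent θ - 1 is negative, so δ is what keeps the potential bounded near zeros of u.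
    have hb : ∀ x, |g x - l| ≤ ν * δ ^ (θ - 1) + l := by
      intro x
      have h1 : (u x ^ 2 + δ) ^ (θ - 1) ≤ δ ^ (θ - 1) :=
        Real.rpow_le_rpow_of_nonpos hδ (by linarith [sq_nonneg (u x)]) (by linarith)
      have h2 : g x ≤ ν * δ ^ (θ - 1) := mul_le_mul_of_nonneg_left h1 hν0.le
      have h3 := hg0 x
      rw [abs_le]
      constructor <;> linarith
    exact pos_of_nonneg_of_ode hu0 hb hd1 hd2 hne
  have hd3 : ∀ x, HasDerivAt g (-((2 - p) * g x * u x * u₁ x / (u x ^ 2 + δ))) x := by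
    intro x
    have hr := (hrpos x).ne'
    have := ((((hd1 x).fun_pow 2).add_const δ).rpow_const (p := θ - 1) (Or.inl hr)).const_mul ν
    refine this.congr_deriv ?_
    simp only [hg]
    rw [Real.rpow_sub_one hr (θ - 1), hθ]
    field_simp
    push_cast
    ring
  have hls : l * (2 - p) < 1 :=
    (mul_le_mul_of_nonneg_right hl1 (by linarith)).trans_lt hsub
  have hconst := eq_const_of_carre_du_champ hl0 (by linarith) (by linarith) hls hδ hpos hd1 hd2 hd3
    hup hu₁p hgp
  have hu1 : ∀ x, u x ^ 2 = 1 := by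
    intro x
    rw [hconst x]
    have : ∀ y, u y ^ 2 = u 0 ^ 2 := fun y => by rw [hconst y]
    simpa [this] using hun
  have hN : X ^ θ⁻¹ = 1 + δ := by
    rw [hX]
    simp only [hu1, integral_const, probReal_univ, one_smul, hN1]
  have hfin := hmin χ hχ hχn
  rw [hN] at hfin
  have : 0 ≤ ∫ y, deriv u y ^ 2 ∂sigma := integral_nonneg fun _ => sq_nonneg _
  linarith

/-- The sharp interpolation inequality on the circle. -/
theorem interpolation {μ p : ℝ} (hμ : 0 ≤ μ) (hp : p ∈ Ico (1 : ℝ) 2) (hsub : μ * (2 - p) ≤ 1)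
    (hχ : MemH1 χ) (hχn : ∫ y, ‖χ y‖ ^ 2 ∂sigma = 1) :
    μ ≤ ∫ y, ‖deriv χ y‖ ^ 2 ∂sigma + μ * normLp p χ ^ 2 := by
  have hp0 : 0 < p := by linarith [hp.1]
  have h2p : 0 < 2 - p := by linarith [hp.2]
  have hθ0 : 0 < p / 2 := by positivity
  have hI : 0 ≤ ∫ y, ‖χ y‖ ^ p ∂sigma := integral_nonneg fun _ => by positivity
  have hn : (∫ y, ‖χ y‖ ^ p ∂sigma) ^ (p / 2)⁻¹ = normLp p χ ^ 2 := by
    rw [normLp_eq hp0 (hχ.memLp _), ← Real.rpow_natCast, ← Real.rpow_mul hI]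
    congr 1
    push_cast
    field_simp
  -- Subadditivity of t ↦ t^{p/2} replaces the regularised norm by an upper bound that is visibly
  -- continuous at δ = 0.
  have hreg : ∀ δ, 0 < δ → (∫ y, (‖χ y‖ ^ 2 + δ) ^ (p / 2) ∂sigma) ^ (p / 2)⁻¹ ≤
      (∫ y, ‖χ y‖ ^ p ∂sigma + δ ^ (p / 2)) ^ (p / 2)⁻¹ := by
    intro δ hδ
    refine Real.rpow_le_rpow (integral_nonneg fun _ => by positivity) ?_ (by positivity)
    have hc : Continuous fun y => ‖χ y‖ ^ p := hχ.continuous.norm.rpow_const fun _ => Or.inr hp0.le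
    have e : ∫ y, ‖χ y‖ ^ p ∂sigma + δ ^ (p / 2) = ∫ y, (‖χ y‖ ^ p + δ ^ (p / 2)) ∂sigma := by
      rw [integral_add (integrable_sigma_of_continuous hc) (integrable_const _), integral_const,
        probReal_univ, one_smul]
    rw [e]
    refine integral_mono (integrable_sigma_of_continuous (continuous_normSq_add_rpow hχ hδ _))
      (integrable_sigma_of_continuous (hc.add continuous_const)) fun y => ?_
    refine (Real.rpow_add_le_add_rpow (by positivity) hδ.le hθ0.le
      (by linarith [hp.2])).trans_eq ?_
    rw [← Real.rpow_natCast, ← Real.rpow_mul (norm_nonneg _)]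
    congr 2
    push_cast
    ring
  -- Strict subcriticality leaves room for the factor 1 + δ; the critical value is reached at the
  -- end by letting μ' increase to μ.
  have key : ∀ μ' : ℝ, 0 < μ' → μ' * (2 - p) < 1 →
      μ' ≤ ∫ y, ‖deriv χ y‖ ^ 2 ∂sigma + μ' * normLp p χ ^ 2 := by
    intro μ' hμ' hlt
    have hev : ∀ᶠ δ in 𝓝[>] (0 : ℝ), μ' * (1 + δ) ≤ ∫ y, ‖deriv χ y‖ ^ 2 ∂sigma +
        μ' * (∫ y, ‖χ y‖ ^ p ∂sigma + δ ^ (p / 2)) ^ (p / 2)⁻¹ := by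
      have hc : Continuous fun δ : ℝ => μ' * (1 + δ) * (2 - p) := by fun_prop
      have h1 : ∀ᶠ δ in 𝓝[>] (0 : ℝ), μ' * (1 + δ) * (2 - p) < 1 :=
        nhdsWithin_le_nhds ((hc.tendsto 0).eventually_lt_const (by simpa using hlt))
      filter_upwards [h1, self_mem_nhdsWithin] with δ hδ1 hδ0
      refine (interpolation_regularized hμ' hδ0 hp hδ1 hχ hχn).trans ?_
      have := mul_le_mul_of_nonneg_left (hreg δ hδ0) hμ'.le
      linarith
    have ht1 : Tendsto (fun δ : ℝ => μ' * (1 + δ)) (𝓝[>] 0) (𝓝 μ') := by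
      have hc : Continuous fun δ : ℝ => μ' * (1 + δ) := by fun_prop
      have := (hc.tendsto 0).mono_left (nhdsWithin_le_nhds (s := Ioi 0))
      simpa using this
    have ht2 : Tendsto (fun δ : ℝ => ∫ y, ‖deriv χ y‖ ^ 2 ∂sigma +
        μ' * (∫ y, ‖χ y‖ ^ p ∂sigma + δ ^ (p / 2)) ^ (p / 2)⁻¹) (𝓝[>] 0)
        (𝓝 (∫ y, ‖deriv χ y‖ ^ 2 ∂sigma + μ' * normLp p χ ^ 2)) := by
      have hc : Continuous fun δ : ℝ => ∫ y, ‖deriv χ y‖ ^ 2 ∂sigma +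
          μ' * (∫ y, ‖χ y‖ ^ p ∂sigma + δ ^ (p / 2)) ^ (p / 2)⁻¹ := by
        refine continuous_const.add (continuous_const.mul (Continuous.rpow_const ?_
          fun _ => Or.inr (inv_nonneg.2 hθ0.le)))
        exact continuous_const.add (continuous_id.rpow_const fun _ => Or.inr hθ0.le)
      have := (hc.tendsto 0).mono_left (nhdsWithin_le_nhds (s := Ioi 0))
      simp only [Real.zero_rpow hθ0.ne', add_zero, hn] at this
      exact this
    exact le_of_tendsto_of_tendsto ht1 ht2 hev
  rcases hμ.eq_or_lt with rfl | hpos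
  · simpa using integral_nonneg (μ := sigma) fun y => sq_nonneg ‖deriv χ y‖
  · have hev : ∀ᶠ μ' in 𝓝[<] μ, μ' ≤ ∫ y, ‖deriv χ y‖ ^ 2 ∂sigma + μ' * normLp p χ ^ 2 :=
      eventually_of_mem (Ioo_mem_nhdsLT hpos) fun μ' hμ' =>
        key μ' hμ'.1 ((mul_lt_mul_of_pos_right hμ'.2 h2p).trans_le hsub)
    have ht : Tendsto (fun μ' : ℝ => ∫ y, ‖deriv χ y‖ ^ 2 ∂sigma + μ' * normLp p χ ^ 2) (𝓝[<] μ)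
        (𝓝 (∫ y, ‖deriv χ y‖ ^ 2 ∂sigma + μ * normLp p χ ^ 2)) :=
      (Continuous.tendsto (by fun_prop) μ).mono_left nhdsWithin_le_nhds
    exact le_of_tendsto_of_tendsto (tendsto_id.mono_left nhdsWithin_le_nhds) ht hev

end Beckner

/-! ### The optimal constant and the lowest eigenvalue in the symmetry range. -/

section OptimalConstant

variable {ψ : ℝ → ℂ} {a p μ : ℝ}

theorem optConst_le (hμ : 0 ≤ μ) (h : MemH1 ψ) (hn : ∫ y, ‖ψ y‖ ^ 2 ∂sigma = 1) :
    optConst a p μ ≤ ∫ y, ‖magDeriv a ψ y‖ ^ 2 ∂sigma + μ * normLp p ψ ^ 2 := by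
  refine csInf_le ⟨0, ?_⟩ ⟨ψ, h, ?_, ?_⟩
  · rintro e ⟨χ, -, -, rfl⟩
    positivity
  · have := normLp_two_sq (h.memLp 2)
    rw [hn] at this
    exact (sq_eq_sq₀ (normLp_nonneg 2 ψ) zero_le_one).1 (by rw [this, one_pow])
  · rw [normLp_two_sq (h.memLp_magDeriv a)]

theorem normLp_norm (r : ℝ) (f : ℝ → ℂ) : normLp r (fun x => ((‖f x‖ : ℝ) : ℂ)) = normLp r f := by
  unfold normLp
  congr 1
  exact eLpNorm_congr_norm_ae (Eventually.of_forall fun x => by simp)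

/-- In the symmetry range, the optimal constant is attained by the constants. -/
theorem optConst_eq (ha : a ∈ Icc (0 : ℝ) (1 / 2)) (hp : p ∈ Ico (1 : ℝ) 2) (hμ : 0 < μ)
    (h : μ * (2 - p) + 4 * a ^ 2 ≤ 1) : optConst a p μ = a ^ 2 + μ := by
  have hp0 : 0 < p := by linarith [hp.1]
  have h2p : 0 < 2 - p := by linarith [hp.2]
  refine le_antisymm ?_ (le_csInf ?_ ?_)
  · refine (optConst_le (ψ := fun _ => 1) hμ.le (memH1_const 1) (by simp)).trans_eq ?_
    rw [normLp_const hp0]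
    simp [magDeriv]
  · refine ⟨_, fun _ => 1, memH1_const 1, ?_, rfl⟩
    rw [normLp_const two_pos, norm_one]
  · rintro e ⟨ψ, hψ, hn, rfl⟩
    have hn' := normLp_two_sq (hψ.memLp 2)
    rw [hn, one_pow] at hn'
    have h1 := hψ.magnetic_lower_bound ha
    rw [← hn', mul_one] at h1
    obtain ⟨hv, hvd⟩ := hψ.norm
    set k := 1 - 4 * a ^ 2 with hk
    have hk0 : 0 < k := by
      have := mul_pos hμ h2p
      linarith
    -- The gradient term of the magnetic bound carries the factor k = 1 - 4a². The assumption on μ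
    -- says exactly that (μ/k)(2 - p) ≤ 1.
    have h2 := interpolation (μ := μ / k) (by positivity) hp
      (by rw [div_mul_eq_mul_div, div_le_one hk0]; linarith) hv
      (by simpa only [Complex.norm_real, norm_norm] using hn'.symm)
    have e : ∫ y, ‖deriv (fun x => ((‖ψ x‖ : ℝ) : ℂ)) y‖ ^ 2 ∂sigma =
        ∫ y, deriv (fun x => ‖ψ x‖) y ^ 2 ∂sigma := by
      refine integral_congr_ae ?_
      filter_upwards [hvd] with y hy
      rw [hy, Complex.norm_real, Real.norm_eq_abs, sq_abs]
    rw [e, normLp_norm] at h2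
    have h3 := mul_le_mul_of_nonneg_left h2 hk0.le
    rw [mul_add, ← mul_assoc, mul_div_cancel₀ _ hk0.ne'] at h3
    rw [normLp_two_sq (hψ.memLp_magDeriv a)]
    linarith

theorem MemH1.inFormDomain_const (h : MemH1 ψ) (c : ℝ) : InFormDomain (fun _ => c) ψ :=
  ⟨h, integrable_sigma_of_continuous (continuous_const.mul (h.continuous.norm.pow 2))⟩

/-- The lowest eigenvalue for a constant potential. -/
theorem isLeast_eigenvalues_const (ha : a ∈ Icc (0 : ℝ) (1 / 2)) (c : ℝ) :
    IsLeast (eigenvalues a fun _ => c) (a ^ 2 + c) := by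
  constructor
  · refine ⟨fun _ => 1, fun h => one_ne_zero (congrFun h 0),
      (memH1_const 1).inFormDomain_const c, memLp_const _, fun χ hχ => ?_⟩
    have hχi : Integrable χ sigma := integrable_sigma_of_continuous hχ.1.continuous
    have hχd : Integrable (deriv χ) sigma := hχ.1.memLp_deriv.integrable (by norm_num)
    have e : ∫ y, conj (magDeriv a χ y) ∂sigma = Complex.I * a * ∫ y, conj (χ y) ∂sigma := by
      rw [integral_conj, integral_conj]
      simp only [magDeriv]
      rw [integral_sub hχd (hχi.const_mul _), hχ.1.integral_deriv_eq_zero, integral_const_mul]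
      simp
    have e1 : ∀ y, magDeriv a (fun _ => 1) y = -(Complex.I * a) := fun y => by simp [magDeriv]
    simp only [magForm, e1, one_mul, mul_one]
    rw [integral_const_mul, integral_const_mul, integral_const_mul, e]
    push_cast
    linear_combination -(a : ℂ) ^ 2 * (∫ y, conj (χ y) ∂sigma) * Complex.I_sq
  · refine fun e' he' => le_of_mem_eigenvalues he' fun χ hχ => ?_
    have h1 := hχ.1.magnetic_lower_bound ha
    have h2 : 0 ≤ ∫ y, deriv (fun x => ‖χ x‖) y ^ 2 ∂sigma := integral_nonneg fun _ => sq_nonneg _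
    have h3 : 0 ≤ 1 - 4 * a ^ 2 := by nlinarith [ha.1, ha.2]
    rw [energy, integral_const_mul]
    nlinarith [mul_nonneg h3 h2]

end OptimalConstant

end MagneticRing

end

theorem proposition3p13 (a p q : ℝ) (ha : a ∈ Set.Icc (0 : ℝ) (1 / 2))
    (hp : p ∈ Set.Ico (1 : ℝ) 2) (hq : q = p / (2 - p)) :
    -- the lower bound on the lowest eigenvalue
    (∀ φ : ℝ → ℝ, Function.Periodic φ (2 * Real.pi) →
      -- `φ` is nonnegative and `φ⁻¹` (which is finite almost everywhere) belongs to `L^q`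
      (∀ᵐ y ∂MagneticRing.sigma, 0 < φ y) →
      MemLp (fun y => (φ y)⁻¹) (ENNReal.ofReal q) MagneticRing.sigma →
      -- the form domain is not `{0}`, as there is no eigenvalue at all otherwise
      (∃ ψ : ℝ → ℂ, ψ ≠ 0 ∧ MagneticRing.InFormDomain φ ψ) →
      ∃ e₁ : ℝ, IsLeast (MagneticRing.eigenvalues a φ) e₁ ∧
        MagneticRing.optConst a p (MagneticRing.normLp q (fun y => (φ y)⁻¹))⁻¹ ≤ e₁) ∧
    -- equality for the constant potentials
    (∀ c : ℝ, 0 < c →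
      (MagneticRing.normLp q (fun _ => c⁻¹))⁻¹ * (2 - p) + 4 * a ^ 2 ≤ 1 →
      IsLeast (MagneticRing.eigenvalues a (fun _ => c))
        (MagneticRing.optConst a p (MagneticRing.normLp q (fun _ => c⁻¹))⁻¹)) := by
  have hq0 : 0 < q := by
    rw [hq]
    exact div_pos (by linarith [hp.1]) (by linarith [hp.2])
  constructor
  · intro φ _ h0 hφ hne
    have hm : AEStronglyMeasurable φ MagneticRing.sigma := by
      have := hφ.1.inv₀
      rwa [show (fun y => (φ y)⁻¹)⁻¹ = φ from funext fun y => inv_inv (φ y)] at this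
    obtain ⟨ψ, hψ, hn, hleast⟩ := MagneticRing.exists_ground_state a hm (h0.mono fun _ h => h.le) hne
    refine ⟨_, hleast, ?_⟩
    refine (MagneticRing.optConst_le (inv_nonneg.2 (MagneticRing.normLp_nonneg q _)) hψ.1 hn).trans
      ?_
    -- Positivity makes the inverse norm a genuine inverse; a zero norm would force φ⁻¹ = 0 almost
    -- everywhere.
    have hnorm : 0 < MagneticRing.normLp q fun y => (φ y)⁻¹ := by
      refine lt_of_le_of_ne (MagneticRing.normLp_nonneg q _) fun hz => ?_
      have hz' := (ENNReal.toReal_eq_zero_iff _).1 hz.symm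
      rw [or_iff_left hφ.2.ne, eLpNorm_eq_zero_iff hφ.1 (by simpa using hq0)] at hz'
      obtain ⟨y, hy1, hy2⟩ := (h0.and hz').exists
      exact (inv_pos.2 hy1).ne' hy2
    have := MagneticRing.normLp_sq_le_mul_integral hp hq h0 hφ hψ
    rw [MagneticRing.energy]
    gcongr
    rwa [inv_mul_le_iff₀ hnorm]
  · intro c hc h
    rw [MagneticRing.normLp_const hq0, norm_inv, inv_inv, Real.norm_of_nonneg hc.le] at h ⊢
    rw [MagneticRing.optConst_eq ha hp hc h]
    exact MagneticRing.isLeast_eigenvalues_const ha c
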